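/- Let $n\ge 1$, $k\ge 2$ and $m>(k-1)n$ be integers. Then there exists $\varepsilon\in(0,1)$, depending only on $n,k,m$, such that the following holds. Let $A_1,\dots,A_k$ be real $n\times m$ matrices forming a non-degenerate system, meaning that for every $1\le j\le k$ the two $m\times(k-1)n$ block matrices $[A_i^{\mathsf T}]_{i\ne j}$ and $[A_i^{\mathsf T}-A_j^{\mathsf T}]_{i\neq j}$ have rank $(k-1)n$. Let $Q\in\mathbb R[y_1,\dots,y_m]$ satisfy $Q(0)=0$ and $\det \mathrm{Hess}\,Q(0)\ne 0$, where $\mathrm{Hess}\,Q=(\partial_i\partial_jQ)_{i,j}$. Let $\psi:\mathbb R^m\to[0,\infty)$ be a smooth compactly supported function such that $\psi\ge 1$ on $[-c,c]^m$ for some $c>0$ and $|\det\mathrm{Hess}\,Q|$ is bounded below by a positive constant on the support of $\psi$. Put $\varphi_j(y)=A_jy$ for $1\le j\le k-1$ and $\varphi_k(y)=A_ky+Q(y)e_n$ with $e_n=(0,\dots,0,1)\in\mathbb R^n$, and define the configuration form $$\Lambda(f_0,\dots,f_k)=\int_{\mathbb R^n}\int_{\mathbb R^m} f_0(x)\,f_1(x+\varphi_1(y))\cdots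 f_k(x+\varphi_k(y))\,\psi(y)\,dy\,dx .$$ Then there is a constant $C>0$, depending only on $n,k,m,(A_i),Q,\psi$, such that for all smooth functions $f_0,\dots,f_k:\mathbb R^n\to\mathbb C$ supported in $[-\tfrac12,\tfrac12]^n$, $$|\Lambda(f_0,\dots,f_k)|\le C\prod_{j=0}^k\|\widehat f_j\|_\infty^{\varepsilon}\,\|f_j\|_\infty^{1-\varepsilon},$$ where $\widehat f(\xi)=\int_{\mathbb R^n}f(x)e^{-2\pi i\,x\cdot\xi}\,dx$ and $\|\cdot\|_\infty$ is the supremum norm. -/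

import Mathlib

open MeasureTheory
open scoped FourierTransform ContDiff Matrix

noncomputable section

/-- The system `A₁, …, A_k` of real `n × m` matrices (here indexed by `Fin k`) is non-degenerate, in
the regime `m ≥ (k - 1) n`: for every `j`, the two `m × (k - 1) n` block matrices
`[A_iᵀ]_{i ≠ j}` and `[A_iᵀ - A_jᵀ]_{i ≠ j}` have rank `(k - 1) n`. -/
def NonDegenerateSystem {n m k : ℕ} (A : Fin k → Matrix (Fin n) (Fin m) ℝ) : Prop :=
  ∀ j : Fin k,
    (Matrix.of fun (a : Fin m) (p : {i : Fin k // i ≠ j} × Fin n) =>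
      (A p.1)ᵀ a p.2).rank = (k - 1) * n ∧
    (Matrix.of fun (a : Fin m) (p : {i : Fin k // i ≠ j} × Fin n) =>
      ((A p.1)ᵀ - (A j)ᵀ) a p.2).rank = (k - 1) * n

/-- The value `Q(y)` of a real polynomial in `m` variables at a point of Euclidean space. -/
def polyValue {m : ℕ} (Q : MvPolynomial (Fin m) ℝ) (y : EuclideanSpace ℝ (Fin m)) : ℝ :=
  MvPolynomial.eval (fun i => y i) Q

/-- The Hessian determinant `det (∂ᵢ ∂ⱼ Q (y))`. -/
def hessianDet {m : ℕ} (Q : MvPolynomial (Fin m) ℝ) (y : EuclideanSpace ℝ (Fin m)) : ℝ :=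
  (Matrix.of fun i j : Fin m =>
    polyValue (MvPolynomial.pderiv i (MvPolynomial.pderiv j Q)) y).det

/-- The last standard basis vector `e_n = (0, …, 0, 1)` of `ℝⁿ`. -/
def lastBasisVector (n : ℕ) : EuclideanSpace ℝ (Fin n) :=
  WithLp.toLp 2 fun i => if (i : ℕ) + 1 = n then 1 else 0

/-- The maps `φ_j(y) = A_j y` for `1 ≤ j ≤ k - 1` and `φ_k(y) = A_k y + Q(y) e_n`; the index
`j : Fin k` stands for `j + 1`. -/
def patternMap {n m k : ℕ} (A : Fin k → Matrix (Fin n) (Fin m) ℝ) (Q : MvPolynomial (Fin m) ℝ)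
    (j : Fin k) (y : EuclideanSpace ℝ (Fin m)) : EuclideanSpace ℝ (Fin n) :=
  WithLp.toLp 2 (A j *ᵥ fun i => y i) +
    if (j : ℕ) + 1 = k then polyValue Q y • lastBasisVector n else 0

/-- The configuration form
`Λ(f₀, …, f_k) = ∫_{ℝⁿ} ∫_{ℝᵐ} f₀(x) f₁(x + φ₁(y)) ⋯ f_k(x + φ_k(y)) ψ(y) dy dx`. -/
def configForm {n m k : ℕ}
    (φ : Fin k → EuclideanSpace ℝ (Fin m) → EuclideanSpace ℝ (Fin n))
    (ψ : EuclideanSpace ℝ (Fin m) → ℝ)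
    (f : Fin (k + 1) → EuclideanSpace ℝ (Fin n) → ℂ) : ℂ :=
  ∫ x : EuclideanSpace ℝ (Fin n), ∫ y : EuclideanSpace ℝ (Fin m),
    f 0 x * (∏ j : Fin k, f j.succ (x + φ j y)) * (ψ y : ℂ)

/-- The supremum norm `‖g‖_∞`. It is only applied to bounded continuous functions, for which it is
the `L^∞` norm. -/
def supNorm {n : ℕ} (g : EuclideanSpace ℝ (Fin n) → ℂ) : ℝ :=
  ⨆ x, ‖g x‖

/-- The cube `[-1/2, 1/2]ⁿ`. -/
def unitCube (n : ℕ) : Set (EuclideanSpace ℝ (Fin n)) :=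
  {x | ∀ i, |x i| ≤ 1 / 2}

end

/-! Let U(x, y) be the product of f₀(x) and of f_i(x + A_i y) for 1 ≤ i < k. Fourier inversion of
f_k alone gives Λ = ∫ 𝓕 f_k(ξ) P(ξ) dξ, where P(ξ) integrates Uψ against the character with phase
x·ξ + A_k y·ξ + ξ_n Q(y). Frequency space is cut at |ξ_n| = J².

High frequencies (`exists_high_frequency_bound`). As m > (k - 1)n, some e ≠ 0 is killed by A_1, …,
A_{k-1}. Then U is constant along e in y, so the oscillating weight may be replaced by its mean over
J translates along e. The correlation of two translates at distance σ has phase ξ_n(Q(y + σe) -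
Q(y)) = ξ_n σ Θ(σ, y), and Θ(0, ·) has gradient Hess Q(y) e, which does not vanish on the support of
ψ. One integration by parts makes off-diagonal correlations O(1/J), so the mean has squared L² norm
O(1/J) uniformly in ξ. Plancherel in x then bounds this part by J^(-1/2) times the product of the
sup norms.

Low frequencies (`exists_low_frequency_bound`). The first rank condition makes the k points x, x +
A_i y independent linear coordinates. Expanding exp(2πi ξ_n Q)ψ in characters η, at polynomial cost
in J, turns P(ξ) into an average of products of the 𝓕 f_i at points affine in (ξ, η). Both rank
conditions together allow coordinates in which each such point depends bijectively on ξ. There are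
at least three factors, so for any index j two others can be put in L² by Cauchy-Schwarz and
Plancherel, and 𝓕 f_j is left in sup norm.

Put F_i = ‖f_i‖_∞, ρ_i = ‖𝓕 f_i‖_∞, J = I² and a = 4(m + 1). For every j this yields |Λ| ≲ (I⁻¹ +
I^a ρ_j/F_j) ∏ F_i (when F_j ≠ 0). Taking I near (F_j/ρ_j)^(1/(2a)) gains (ρ_j/F_j)^(1/(2a)), and
the geometric mean over the k + 1 indices gives ε = 1/(2a(k + 1)). -/

/-! ### Characters, Plancherel and Fourier inversion -/

/-- The character `t ↦ exp (2 π i t)`. -/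
noncomputable def unitExp (t : ℝ) : ℂ := Complex.exp (2 * Real.pi * t * Complex.I)

theorem coe_fourierChar_eq_unitExp (t : ℝ) : (Real.fourierChar t : ℂ) = unitExp t := by
  rw [Real.fourierChar_apply, unitExp]
  push_cast
  rfl

@[simp] theorem norm_unitExp (t : ℝ) : ‖unitExp t‖ = 1 := by
  rw [← coe_fourierChar_eq_unitExp, Circle.norm_coe]

@[simp] theorem enorm_unitExp (t : ℝ) : ‖unitExp t‖ₑ = 1 := by
  rw [← ofReal_norm, norm_unitExp, ENNReal.ofReal_one]

theorem unitExp_add (s t : ℝ) : unitExp (s + t) = unitExp s * unitExp t := by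
  rw [unitExp, unitExp, unitExp, ← Complex.exp_add]
  push_cast
  ring_nf

theorem star_unitExp (t : ℝ) : (starRingEnd ℂ) (unitExp t) = unitExp (-t) := by
  rw [unitExp, unitExp, ← Complex.exp_conj]
  simp [Complex.conj_ofNat]

theorem contDiff_unitExp : ContDiff ℝ ∞ unitExp := by
  unfold unitExp
  exact ((contDiff_const.mul Complex.ofRealCLM.contDiff).mul contDiff_const).cexp

@[fun_prop] theorem continuous_unitExp : Continuous unitExp := contDiff_unitExp.continuous

theorem hasDerivAt_unitExp (t : ℝ) :
    HasDerivAt unitExp (2 * Real.pi * Complex.I * unitExp t) t := by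
  simpa only [coe_fourierChar_eq_unitExp] using Real.hasDerivAt_fourierChar t

/-- Plancherel's identity for smooth compactly supported functions. -/
theorem lintegral_enorm_sq_fourier {E : Type*} [NormedAddCommGroup E] [InnerProductSpace ℝ E]
    [FiniteDimensional ℝ E] [MeasurableSpace E] [BorelSpace E] {f : E → ℂ}
    (hf : ContDiff ℝ ∞ f) (hc : HasCompactSupport f) :
    ∫⁻ ξ, ‖𝓕 f ξ‖ₑ ^ 2 = ∫⁻ x, ‖f x‖ₑ ^ 2 := by
  have key : ∀ h : SchwartzMap E ℂ,
      ∫⁻ x, ‖h x‖ₑ ^ 2 = ENNReal.ofReal (∫ x, ‖h x‖ ^ 2) := by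
    intro h
    rw [ofReal_integral_eq_lintegral_ofReal]
    · congr 1 with x
      rw [ENNReal.ofReal_pow (norm_nonneg _), ofReal_norm]
    · exact (h.memLp 2 volume).integrable_norm_pow (by norm_num)
    · filter_upwards with x using by positivity
  set g := hc.toSchwartzMap hf
  have e1 : ∀ x, g x = f x := fun x => rfl
  have e2 : ∀ ξ, (𝓕 g) ξ = 𝓕 f ξ := fun x => rfl
  have h1 := key g
  have h2 := key (𝓕 g)
  rw [SchwartzMap.integral_norm_sq_fourier, ← h1] at h2
  simpa only [e1, e2] using h2

theorem integrable_fourier {E : Type*} [NormedAddCommGroup E] [InnerProductSpace ℝ E]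
    [FiniteDimensional ℝ E] [MeasurableSpace E] [BorelSpace E] {f : E → ℂ}
    (hf : ContDiff ℝ ∞ f) (hc : HasCompactSupport f) : Integrable (𝓕 f) :=
  (𝓕 (hc.toSchwartzMap hf)).integrable

theorem continuous_fourier {E : Type*} [NormedAddCommGroup E] [InnerProductSpace ℝ E]
    [FiniteDimensional ℝ E] [MeasurableSpace E] [BorelSpace E] {f : E → ℂ}
    (hf : ContDiff ℝ ∞ f) (hc : HasCompactSupport f) : Continuous (𝓕 f) :=
  (𝓕 (hc.toSchwartzMap hf)).continuous

/-- Fourier inversion for smooth compactly supported functions. -/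
theorem eq_integral_fourier {E : Type*} [NormedAddCommGroup E] [InnerProductSpace ℝ E]
    [FiniteDimensional ℝ E] [MeasurableSpace E] [BorelSpace E] {f : E → ℂ}
    (hf : ContDiff ℝ ∞ f) (hc : HasCompactSupport f) (x : E) :
    f x = ∫ ξ, 𝓕 f ξ * unitExp (inner ℝ x ξ) := by
  have h := congrFun (hf.continuous.fourierInv_fourier_eq
    (hf.continuous.integrable_of_hasCompactSupport hc) (integrable_fourier hf hc)) x
  rw [← h, Real.fourierInv_eq]
  congr 1 with ξ
  rw [Circle.smul_def, coe_fourierChar_eq_unitExp, smul_eq_mul, mul_comm, real_inner_comm]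

/-- The pairing of a weight with `g ∘ φ`, written on the Fourier side of `g`. -/
theorem integral_mul_comp_eq_integral_fourier {E Z : Type*} [NormedAddCommGroup E]
    [InnerProductSpace ℝ E] [FiniteDimensional ℝ E] [MeasurableSpace E] [BorelSpace E]
    [MeasurableSpace Z] {μ : Measure Z} [SFinite μ] {g : E → ℂ}
    (hg : ContDiff ℝ ∞ g) (hc : HasCompactSupport g) {W : Z → ℂ} (hW : Integrable W μ)
    {φ : Z → E} (hφ : Measurable φ) :
    ∫ z, W z * g (φ z) ∂μ =
      ∫ ξ, 𝓕 g ξ * ∫ z, W z * unitExp (inner ℝ (φ z) ξ) ∂μ := by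
  have hint : Integrable (fun p : Z × E =>
      W p.1 * 𝓕 g p.2 * unitExp (inner ℝ (φ p.1) p.2)) (μ.prod volume) := by
    refine (hW.mul_prod (integrable_fourier hg hc)).mul_bdd (c := 1) ?_ ?_
    · apply Measurable.aestronglyMeasurable
      have h1 : Measurable fun p : Z × E => inner ℝ (φ p.1) p.2 :=
        (hφ.comp measurable_fst).inner measurable_snd
      exact continuous_unitExp.measurable.comp h1
    · filter_upwards with p using by simp
  calc ∫ z, W z * g (φ z) ∂μ
      = ∫ z, (∫ ξ, W z * 𝓕 g ξ * unitExp (inner ℝ (φ z) ξ)) ∂μ := by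
        congr 1 with z
        rw [eq_integral_fourier hg hc (φ z), ← integral_const_mul]
        simp only [mul_assoc]
    _ = ∫ ξ, ∫ z, W z * 𝓕 g ξ * unitExp (inner ℝ (φ z) ξ) ∂μ :=
        integral_integral_swap hint
    _ = _ := by
        congr 1 with ξ
        rw [← integral_const_mul]
        congr 1 with z
        ring

/-! ### Nonstationary phase with a parameter -/

theorem hasCompactSupport_slice {T Y F : Type*} [TopologicalSpace T] [TopologicalSpace Y]
    [R1Space Y] [Zero F] {G : T × Y → F} (hc : HasCompactSupport G) (τ : T) :
    HasCompactSupport fun y => G (τ, y) := by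
  refine HasCompactSupport.intro (hc.isCompact.image continuous_snd) fun y hy => ?_
  by_contra h
  exact hy ⟨(τ, y), subset_tsupport _ h, rfl⟩

/-- All slices live in one compact set, the projection of the support, which makes the bound uniform
in the parameter. -/
theorem exists_integral_norm_slice_le {T Y F : Type*} [TopologicalSpace T] [TopologicalSpace Y]
    [R1Space Y] [MeasurableSpace Y] [OpensMeasurableSpace Y] {μ : Measure Y}
    [IsFiniteMeasureOnCompacts μ] [NormedAddCommGroup F] {G : T × Y → F} (hG : Continuous G)
    (hc : HasCompactSupport G) : ∃ C : ℝ, 0 ≤ C ∧ ∀ τ, ∫ y, ‖G (τ, y)‖ ∂μ ≤ C := by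
  obtain ⟨M, hM⟩ := hc.exists_bound_of_continuous hG
  set K := closure (Prod.snd '' tsupport G) with hK
  have hKc : IsCompact K := (hc.isCompact.image continuous_snd).closure
  refine ⟨|M| * μ.real K, by positivity, fun τ => ?_⟩
  have h0 : ∀ y, y ∉ K → ‖G (τ, y)‖ = 0 := by
    intro y hy
    by_contra h
    exact hy (subset_closure ⟨(τ, y), subset_tsupport _ (by simpa using h), rfl⟩)
  rw [← setIntegral_eq_integral_of_forall_compl_eq_zero h0]
  refine (Real.le_norm_self _).trans
    (norm_setIntegral_le_of_norm_le_const hKc.measure_lt_top fun y _ => ?_)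
  rw [norm_norm]
  exact (hM _).trans (le_abs_self M)

theorem fderiv_slice_apply {T Y F : Type*} [NormedAddCommGroup T] [NormedSpace ℝ T]
    [NormedAddCommGroup Y] [NormedSpace ℝ Y] [NormedAddCommGroup F] [NormedSpace ℝ F]
    {G : T × Y → F} (hG : Differentiable ℝ G) (τ : T) (y v : Y) :
    fderiv ℝ (fun z => G (τ, z)) y v = fderiv ℝ G (τ, y) (0, v) := by
  have h := (hG (τ, y)).hasFDerivAt.comp y
    ((hasFDerivAt_const τ y).prodMk (hasFDerivAt_id (𝕜 := ℝ) y))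
  have h2 := h.fderiv
  exact (DFunLike.congr_fun h2 v).trans (by simp)

theorem fderiv_unitExp_comp {Y : Type*} [NormedAddCommGroup Y] [NormedSpace ℝ Y] {θ : Y → ℝ}
    {y : Y} (hθ : DifferentiableAt ℝ θ y) (v : Y) :
    fderiv ℝ (fun z => unitExp (θ z)) y v =
      2 * Real.pi * Complex.I * (fderiv ℝ θ y v : ℂ) * unitExp (θ y) := by
  have h := ((hasDerivAt_unitExp (θ y)).hasFDerivAt.comp y hθ.hasFDerivAt).fderiv
  refine (DFunLike.congr_fun h v).trans ?_
  simp
  ring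

/-- Nonstationary phase, with one integration by parts, uniformly in a parameter `τ`. -/
theorem exists_oscillatory_bound {T Y : Type*} [NormedAddCommGroup T] [NormedSpace ℝ T]
    [NormedAddCommGroup Y] [NormedSpace ℝ Y]
    [FiniteDimensional ℝ Y] [MeasurableSpace Y] [BorelSpace Y] {μ : Measure Y}
    [μ.IsAddHaarMeasure] {Θ a : T × Y → ℝ} (hΘ : ContDiff ℝ ∞ Θ) (ha : ContDiff ℝ ∞ a)
    (hc : HasCompactSupport a) (hne : ∀ p ∈ tsupport a, ∃ v : Y, fderiv ℝ Θ p (0, v) ≠ 0) :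
    ∃ C : ℝ, 0 ≤ C ∧ ∀ (s : ℝ) (τ : T),
      |s| * ‖∫ y, unitExp (s * Θ (τ, y)) * (a (τ, y) : ℂ) ∂μ‖ ≤ C := by
  let b := Module.finBasis ℝ Y
  set d : Fin (Module.finrank ℝ Y) → T × Y → ℝ := fun i p => fderiv ℝ Θ p (0, b i) with hd
  have hdC : ∀ i, ContDiff ℝ ∞ (d i) := fun i =>
    (hΘ.fderiv_right (m := ∞) (by simp)).clm_apply contDiff_const
  set D : T × Y → ℝ := fun p => ∑ i, d i p ^ 2 with hD
  have hDC : ContDiff ℝ ∞ D := ContDiff.sum fun i _ => (hdC i).pow 2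
  have hD0 : ∀ p ∈ tsupport a, D p ≠ 0 := by
    intro p hp h0
    obtain ⟨v, hv⟩ := hne p hp
    have h1 : ∀ i, d i p = 0 := by
      intro i
      have := (Finset.sum_eq_zero_iff_of_nonneg (fun i _ => sq_nonneg (d i p))).1 h0 i
        (Finset.mem_univ i)
      simpa using this
    apply hv
    have h2 : ((fderiv ℝ Θ p : T × Y →ₗ[ℝ] ℝ) ∘ₗ LinearMap.inr ℝ T Y) = 0 :=
      b.ext fun i => by simpa using h1 i
    simpa using LinearMap.congr_fun h2 v
  -- Components of the field a∇Θ/|∇Θ|², with gradient in the second variable only. Where `D`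
  -- vanishes, `a` vanishes nearby, so the junk value of the division is 0 and smoothness survives.
  set g : Fin (Module.finrank ℝ Y) → T × Y → ℂ := fun i p => ((a p * d i p / D p : ℝ) : ℂ) with hg
  have hgC : ∀ i, ContDiff ℝ ∞ (g i) := by
    intro i
    refine Complex.ofRealCLM.contDiff.comp (f := fun p => a p * d i p / D p)
      (contDiff_iff_contDiffAt.2 fun p => ?_)
    by_cases hp : p ∈ tsupport a
    · exact (ha.mul (hdC i)).contDiffAt.div hDC.contDiffAt (hD0 p hp)
    · refine (contDiffAt_const (c := (0 : ℝ))).congr_of_eventuallyEq ?_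
      filter_upwards [notMem_tsupport_iff_eventuallyEq.1 hp] with q hq
      have hq0 : a q = 0 := hq
      simp only [hq0, zero_mul, zero_div]
  have hgc : ∀ i, HasCompactSupport (g i) := by
    intro i
    refine hc.mono' ((Function.support_subset_iff'.2 fun p hp => ?_).trans (subset_tsupport a))
    simp [hg, Function.notMem_support.1 hp]
  have hg'C : ∀ i, Continuous fun p => fderiv ℝ (g i) p (0, b i) := fun i =>
    ((hgC i).continuous_fderiv (by simp)).clm_apply continuous_const
  have hg'c : ∀ i, HasCompactSupport fun p => fderiv ℝ (g i) p (0, b i) := fun i =>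
    (hgc i).fderiv_apply ℝ _
  choose C hC0 hC using fun i => exists_integral_norm_slice_le (μ := μ) (hg'C i) (hg'c i)
  refine ⟨∑ i, C i, Finset.sum_nonneg fun i _ => hC0 i, fun s τ => ?_⟩
  have hΘd : Differentiable ℝ Θ := hΘ.differentiable (by simp)
  have hsl : ContDiff ℝ ∞ fun y : Y => s * Θ (τ, y) :=
    contDiff_const.mul (hΘ.comp (contDiff_const.prodMk contDiff_id))
  have hf : ContDiff ℝ ∞ fun y : Y => unitExp (s * Θ (τ, y)) := contDiff_unitExp.comp hsl
  have hgs : ∀ i, ContDiff ℝ ∞ fun y : Y => g i (τ, y) := fun i =>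
    (hgC i).comp (contDiff_const.prodMk contDiff_id)
  have hgsc : ∀ i, HasCompactSupport fun y : Y => g i (τ, y) := fun i =>
    hasCompactSupport_slice (hgc i) τ
  have hfd : ∀ i y, fderiv ℝ (fun z => unitExp (s * Θ (τ, z))) y (b i) =
      2 * Real.pi * Complex.I * ((s * d i (τ, y) : ℝ) : ℂ) * unitExp (s * Θ (τ, y)) := by
    intro i y
    rw [fderiv_unitExp_comp (hsl.differentiable (by simp) y)]
    congr 3
    rw [fderiv_slice_apply (G := fun p => s * Θ p) (hΘd.const_mul s),
      fderiv_const_mul (hΘd _)]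
    simp [hd]
  have hint1 : ∀ i, Integrable (fun y =>
      fderiv ℝ (fun z => unitExp (s * Θ (τ, z))) y (b i) * g i (τ, y)) μ := fun i =>
    (((hf.continuous_fderiv (by simp)).clm_apply continuous_const).mul
      (hgs i).continuous).integrable_of_hasCompactSupport (hgsc i).mul_left
  have hparts : ∀ i, ‖∫ y, fderiv ℝ (fun z => unitExp (s * Θ (τ, z))) y (b i) * g i (τ, y) ∂μ‖
      ≤ C i := by
    intro i
    rw [← norm_neg, ← integral_mul_fderiv_eq_neg_fderiv_mul_of_integrable (hint1 i)]
    · refine (norm_integral_le_integral_norm _).trans ((le_of_eq ?_).trans (hC i τ))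
      congr 1 with y
      rw [norm_mul, norm_unitExp, one_mul, fderiv_slice_apply ((hgC i).differentiable (by simp))]
    · exact (hf.continuous.mul (((hgs i).continuous_fderiv (by simp)).clm_apply
        continuous_const)).integrable_of_hasCompactSupport ((hgsc i).fderiv_apply ℝ _).mul_left
    · exact (hf.continuous.mul (hgs i).continuous).integrable_of_hasCompactSupport (hgsc i).mul_left
    · exact fun y _ => hf.differentiable (by simp) y
    · exact fun y _ => (hgs i).differentiable (by simp) y
  -- Differentiating the character along the field gives back 2πi s · a times the character, since
  -- the field pairs with ∇Θ to `a`.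
  have hsum : 2 * Real.pi * Complex.I * s * ∫ y, unitExp (s * Θ (τ, y)) * (a (τ, y) : ℂ) ∂μ =
      ∑ i, ∫ y, fderiv ℝ (fun z => unitExp (s * Θ (τ, z))) y (b i) * g i (τ, y) ∂μ := by
    rw [← integral_finsetSum _ fun i _ => hint1 i, ← integral_const_mul]
    congr 1 with y
    by_cases hp : a (τ, y) = 0
    · simp [hg, hp]
    · have hDp := hD0 _ (subset_tsupport a hp)
      have : a (τ, y) = ∑ i, d i (τ, y) * (a (τ, y) * d i (τ, y) / D (τ, y)) := by
        have h1 : ∀ i, d i (τ, y) * (a (τ, y) * d i (τ, y) / D (τ, y)) =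
            d i (τ, y) ^ 2 * (a (τ, y) / D (τ, y)) := fun i => by ring
        simp only [h1]
        rw [← Finset.sum_mul]
        exact (mul_div_cancel₀ _ hDp).symm
      conv_lhs => rw [this]
      rw [Complex.ofReal_sum, Finset.mul_sum, Finset.mul_sum]
      refine Finset.sum_congr rfl fun i _ => ?_
      rw [hfd]
      simp only [hg]
      push_cast
      ring
  have hn := congrArg norm hsum
  rw [norm_mul] at hn
  have h2 : ‖(2 * Real.pi * Complex.I * s : ℂ)‖ = 2 * Real.pi * |s| := by
    simp [abs_of_pos Real.pi_pos]
  rw [h2] at hn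
  have h3 := (norm_sum_le Finset.univ fun i =>
    ∫ y, fderiv ℝ (fun z => unitExp (s * Θ (τ, z))) y (b i) * g i (τ, y) ∂μ).trans
    (Finset.sum_le_sum fun i _ => hparts i)
  rw [← hn] at h3
  refine le_trans ?_ h3
  have hpi : 1 ≤ 2 * Real.pi := by linarith [Real.pi_gt_three]
  rw [mul_assoc]
  exact le_mul_of_one_le_left (by positivity) hpi

/-! ### Derivatives and difference quotients of polynomials -/

theorem contDiff_polyValue {m : ℕ} (Q : MvPolynomial (Fin m) ℝ) :
    ContDiff ℝ ∞ (polyValue Q) := by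
  induction Q using MvPolynomial.induction_on with
  | C a =>
    have h : polyValue (MvPolynomial.C a) = fun _ : EuclideanSpace ℝ (Fin m) => a := by
      funext y
      simp [polyValue]
    exact h ▸ contDiff_const
  | add p q hp hq =>
    have h : polyValue (p + q) = fun y => polyValue p y + polyValue q y := by
      funext y
      simp [polyValue]
    exact h ▸ hp.add hq
  | mul_X p i hp =>
    have hi : ContDiff ℝ ∞ fun y : EuclideanSpace ℝ (Fin m) => y i := contDiff_piLp_apply 2
    have h : polyValue (p * MvPolynomial.X i) = fun y => polyValue p y * y i := by
      funext y
      simp [polyValue]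
    exact h ▸ hp.mul hi

theorem fderiv_polyValue {m : ℕ} (Q : MvPolynomial (Fin m) ℝ) (y v : EuclideanSpace ℝ (Fin m)) :
    fderiv ℝ (polyValue Q) y v = ∑ j, v j * polyValue (MvPolynomial.pderiv j Q) y := by
  induction Q using MvPolynomial.induction_on with
  | C a =>
    have h : polyValue (MvPolynomial.C a) = fun _ : EuclideanSpace ℝ (Fin m) => a := by
      funext y
      simp [polyValue]
    rw [h]
    simp [polyValue]
  | add p q hp hq =>
    have h : polyValue (p + q) = fun y => polyValue p y + polyValue q y := by
      funext y
      simp [polyValue]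
    rw [h, fderiv_fun_add ((contDiff_polyValue p).differentiable (by simp) y)
      ((contDiff_polyValue q).differentiable (by simp) y), _root_.add_apply, hp, hq,
      ← Finset.sum_add_distrib]
    simp [polyValue, mul_add]
  | mul_X p i hp =>
    have h : polyValue (p * MvPolynomial.X i) = fun y => polyValue p y * y i := by
      funext y
      simp [polyValue]
    have hi : HasFDerivAt (fun y : EuclideanSpace ℝ (Fin m) => y i)
        (EuclideanSpace.proj (𝕜 := ℝ) i : EuclideanSpace ℝ (Fin m) →L[ℝ] ℝ) y :=
      (EuclideanSpace.proj (𝕜 := ℝ) i : EuclideanSpace ℝ (Fin m) →L[ℝ] ℝ).hasFDerivAt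
    rw [h, fderiv_fun_mul ((contDiff_polyValue p).differentiable (by simp) y)
      hi.differentiableAt, hi.fderiv]
    have h2 : ∀ j, polyValue (MvPolynomial.pderiv j (p * MvPolynomial.X i)) y =
        polyValue (MvPolynomial.pderiv j p) y * y i + polyValue p y * (Pi.single i 1 : Fin m → ℝ) j := by
      intro j
      rw [MvPolynomial.pderiv_mul, MvPolynomial.pderiv_X]
      by_cases hij : i = j
      · subst hij
        simp [polyValue]
      · simp [polyValue, hij, Ne.symm hij]
    simp only [h2, mul_add, Finset.sum_add_distrib]
    simp only [_root_.add_apply, _root_.smul_apply, hp, smul_eq_mul,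
      Pi.single_apply, mul_ite, mul_one, mul_zero, Finset.sum_ite_eq',
      Finset.mem_univ, if_true]
    rw [Finset.mul_sum, add_comm]
    congr 1
    · exact Finset.sum_congr rfl fun j _ => by ring
    · change polyValue p y * v i = _
      exact mul_comm (polyValue p y) (v i)

/-- The increment of a polynomial in a direction `e`, divided by the step. -/
theorem exists_polyValue_add_smul {m : ℕ} (Q : MvPolynomial (Fin m) ℝ)
    (e : EuclideanSpace ℝ (Fin m)) :
    ∃ Θ : ℝ × EuclideanSpace ℝ (Fin m) → ℝ, ContDiff ℝ ∞ Θ ∧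
      ∀ τ y, polyValue Q (y + τ • e) = polyValue Q y + τ * Θ (τ, y) := by
  induction Q using MvPolynomial.induction_on with
  | C a => exact ⟨fun _ => 0, contDiff_const, fun τ y => by simp [polyValue]⟩
  | add p q hp hq =>
    obtain ⟨Θ, h1, h2⟩ := hp
    obtain ⟨Θ', h1', h2'⟩ := hq
    refine ⟨fun p => Θ p + Θ' p, h1.add h1', fun τ y => ?_⟩
    have e1 : ∀ z, polyValue (p + q) z = polyValue p z + polyValue q z := fun z => by
      simp [polyValue]
    rw [e1, e1, h2, h2']
    ring
  | mul_X p i hp =>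
    obtain ⟨Θ, h1, h2⟩ := hp
    have hi : ContDiff ℝ ∞ fun z : ℝ × EuclideanSpace ℝ (Fin m) => z.2 i :=
      (contDiff_piLp_apply 2).comp contDiff_snd
    -- Discrete product rule; no division by τ occurs, so the quotient is smooth across τ = 0.
    refine ⟨fun z => Θ z * (z.2 i + z.1 * e i) + polyValue p z.2 * e i,
      (h1.mul (hi.add (contDiff_fst.mul contDiff_const))).add
        (((contDiff_polyValue p).comp contDiff_snd).mul contDiff_const), fun τ y => ?_⟩
    have e1 : ∀ z, polyValue (p * MvPolynomial.X i) z = polyValue p z * z i := fun z => by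
      simp [polyValue]
    rw [e1, e1, h2]
    simp
    ring

/-- At τ = 0 the difference quotient is the directional derivative of Q along e, and the gradient of
that is the Hessian applied to e. -/
theorem fderiv_slice_ne_zero_of_hessianDet_ne_zero {m : ℕ} {Q : MvPolynomial (Fin m) ℝ}
    {e : EuclideanSpace ℝ (Fin m)} (he : e ≠ 0) {Θ : ℝ × EuclideanSpace ℝ (Fin m) → ℝ}
    (hΘ : ContDiff ℝ ∞ Θ)
    (hQ : ∀ τ y, polyValue Q (y + τ • e) = polyValue Q y + τ * Θ (τ, y))
    {y : EuclideanSpace ℝ (Fin m)} (hy : hessianDet Q y ≠ 0) :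
    ∃ v, fderiv ℝ Θ (0, y) (0, v) ≠ 0 := by
  have h0 : (fun y => Θ (0, y)) =
      fun y => ∑ j, e j * polyValue (MvPolynomial.pderiv j Q) y := by
    funext y
    have d1 : HasDerivAt (fun τ : ℝ => polyValue Q (y + τ • e)) (fderiv ℝ (polyValue Q) y e) 0 := by
      have h1 : HasDerivAt (fun τ : ℝ => y + τ • e) e 0 := by
        simpa using ((hasDerivAt_id (0 : ℝ)).smul_const e).const_add y
      have h2 : HasFDerivAt (polyValue Q) (fderiv ℝ (polyValue Q) y) (y + (0 : ℝ) • e) := by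
        simpa using ((contDiff_polyValue Q).differentiable (by simp) y).hasFDerivAt
      exact h2.comp_hasDerivAt 0 h1
    have d2 : HasDerivAt (fun τ : ℝ => polyValue Q y + τ * Θ (τ, y)) (Θ (0, y)) 0 := by
      have h1 : DifferentiableAt ℝ (fun τ : ℝ => Θ (τ, y)) 0 :=
        (hΘ.comp (contDiff_id.prodMk contDiff_const)).differentiable (by simp) 0
      simpa using ((hasDerivAt_id (0 : ℝ)).mul h1.hasDerivAt).const_add (polyValue Q y)
    rw [← fderiv_polyValue]
    simp only [hQ] at d1
    exact d2.unique d1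
  set H := Matrix.of fun i j : Fin m =>
    polyValue (MvPolynomial.pderiv i (MvPolynomial.pderiv j Q)) y with hH
  have hdet : H.det ≠ 0 := hy
  set w := H *ᵥ fun i => e i with hw
  have hfd : ∀ v, fderiv ℝ Θ (0, y) (0, v) = ∑ i, v i * w i := by
    intro v
    rw [← fderiv_slice_apply (hΘ.differentiable (by simp)), h0, fderiv_fun_sum]
    · simp only [_root_.sum_apply]
      have : ∀ j, fderiv ℝ (fun y => e j * polyValue (MvPolynomial.pderiv j Q) y) y v =
          ∑ i, v i * (H i j * e j) := by
        intro j
        rw [fderiv_const_mul ((contDiff_polyValue _).differentiable (by simp) y),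
          _root_.smul_apply, fderiv_polyValue, smul_eq_mul, Finset.mul_sum]
        exact Finset.sum_congr rfl fun i _ => by simp [hH]; ring
      simp only [this]
      rw [Finset.sum_comm]
      refine Finset.sum_congr rfl fun i _ => ?_
      rw [← Finset.mul_sum]
      rfl
    · exact fun j _ => ((contDiff_polyValue _).differentiable (by simp) y).const_mul _
  have hw0 : w ≠ 0 := by
    intro h
    apply he
    have := Matrix.eq_zero_of_mulVec_eq_zero hdet h
    ext i
    exact congrFun this i
  -- Along its own gradient `w` the derivative is |w|².
  refine ⟨WithLp.toLp 2 w, ?_⟩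
  rw [hfd]
  intro h
  apply hw0
  funext i
  have := (Finset.sum_eq_zero_iff_of_nonneg (fun i _ => mul_self_nonneg (w i))).1 h i
    (Finset.mem_univ i)
  simpa using this

/-! ### Correlations of translates and their averages -/

/-- Decay of the correlation of `exp (2 π i s q) ψ` with its translates in the direction `e`. -/
theorem exists_correlation_bound {Y : Type*} [NormedAddCommGroup Y] [NormedSpace ℝ Y]
    [FiniteDimensional ℝ Y] [MeasurableSpace Y] [BorelSpace Y] {μ : Measure Y}
    [μ.IsAddHaarMeasure] {q ψ : Y → ℝ} (hψ : ContDiff ℝ ∞ ψ) (hc : HasCompactSupport ψ) {e : Y}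
    {Θ : ℝ × Y → ℝ} (hΘ : ContDiff ℝ ∞ Θ) (hq : ∀ τ y, q (y + τ • e) = q y + τ * Θ (τ, y))
    (hne : ∀ y ∈ tsupport ψ, ∃ v, fderiv ℝ Θ (0, y) (0, v) ≠ 0) :
    ∃ r : ℝ, 0 < r ∧ ∃ C : ℝ, 0 ≤ C ∧ ∀ s σ : ℝ, |σ| ≤ r →
      |s| * |σ| * ‖∫ y, unitExp (s * (q (y + σ • e) - q y)) * (ψ (y + σ • e) * ψ y : ℝ) ∂μ‖ ≤ C := by
  have hU : IsOpen {p : ℝ × Y | ∃ v : Y, fderiv ℝ Θ p (0, v) ≠ 0} := by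
    rw [Set.ofPred_exists]
    exact isOpen_iUnion fun v => isOpen_ne_fun
      ((hΘ.continuous_fderiv (by simp)).clm_apply continuous_const) continuous_const
  -- Nondegeneracy is known only at σ = 0; openness and compactness of the support of ψ extend it to
  -- small σ.
  obtain ⟨u, v, hu, -, hu0, hKv, huv⟩ := generalized_tube_lemma (isCompact_singleton (x := (0 : ℝ)))
    hc.isCompact hU (by
      rintro ⟨σ, y⟩ ⟨h1, h2⟩
      obtain rfl : σ = 0 := h1
      exact hne y h2)
  obtain ⟨R, hR, hRu⟩ := Metric.nhds_basis_closedBall.mem_iff.1 (hu.mem_nhds (hu0 rfl))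
  -- The cut-off in σ gives the amplitude compact support in the product and is 1 for |σ| ≤ R/2,
  -- whence the radius returned below.
  let χ : ContDiffBump (0 : ℝ) := ⟨R / 2, R, by positivity, by linarith⟩
  set a : ℝ × Y → ℝ := fun p => χ p.1 * (ψ (p.2 + p.1 • e) * ψ p.2) with ha
  have haC : ContDiff ℝ ∞ a := (χ.contDiff.comp contDiff_fst).mul
    ((hψ.comp (contDiff_snd.add (contDiff_fst.smul contDiff_const))).mul (hψ.comp contDiff_snd))
  have hsub : tsupport a ⊆ Metric.closedBall 0 R ×ˢ tsupport ψ := by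
    refine closure_minimal ?_ (Metric.isClosed_closedBall.prod (isClosed_tsupport ψ))
    intro p hp
    refine ⟨?_, subset_tsupport ψ (right_ne_zero_of_mul (right_ne_zero_of_mul hp))⟩
    have : p.1 ∈ tsupport χ := subset_tsupport _ (left_ne_zero_of_mul hp)
    rwa [χ.tsupport_eq] at this
  have hac : HasCompactSupport a :=
    ((isCompact_closedBall _ _).prod hc.isCompact).of_isClosed_subset (isClosed_tsupport a) hsub
  obtain ⟨C, hC0, hC⟩ := exists_oscillatory_bound (μ := μ) hΘ haC hac fun p hp =>
    huv ⟨hRu (hsub hp).1, hKv (hsub hp).2⟩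
  refine ⟨R / 2, by positivity, C, hC0, fun s σ hσ => ?_⟩
  -- The phase is s(q(y + σe) - q(y)) = sσ Θ(σ, y), so the large parameter is sσ.
  have h := hC (s * σ) σ
  rw [abs_mul] at h
  refine (le_of_eq ?_).trans h
  congr 2
  congr 1 with y
  have h1 : χ σ = 1 := χ.one_of_mem_closedBall (by simpa using hσ)
  rw [hq]
  simp only [ha, h1, one_mul]
  congr 2
  ring

/-- Expand the square; by translation invariance each cross term depends only on the difference of
the two shifts. -/
theorem integral_norm_sq_sum_translate_le {Y : Type*} [NormedAddCommGroup Y]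
    [MeasurableSpace Y] [BorelSpace Y] {μ : Measure Y} [μ.IsAddHaarMeasure]
    {G : Y → ℂ} (hG : Continuous G) (hc : HasCompactSupport G) {ι : Type*}
    (t : Finset ι) (w : ι → Y) :
    ∫ y, ‖∑ j ∈ t, G (y + w j)‖ ^ 2 ∂μ ≤
      ∑ j ∈ t, ∑ l ∈ t, ‖∫ y, G (y + (w j - w l)) * (starRingEnd ℂ) (G y) ∂μ‖ := by
  have hint : ∀ j l, Integrable (fun y => G (y + w j) * (starRingEnd ℂ) (G (y + w l))) μ := by
    intro j l
    refine Continuous.integrable_of_hasCompactSupport (by fun_prop) ?_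
    exact (hc.comp_homeomorph (Homeomorph.addRight (w j))).mul_right
  have h1 : ((∫ y, ‖∑ j ∈ t, G (y + w j)‖ ^ 2 ∂μ : ℝ) : ℂ) =
      ∑ j ∈ t, ∑ l ∈ t, ∫ y, G (y + (w j - w l)) * (starRingEnd ℂ) (G y) ∂μ := by
    rw [← integral_complex_ofReal]
    have h2 : ∀ y, ((‖∑ j ∈ t, G (y + w j)‖ ^ 2 : ℝ) : ℂ) =
        ∑ j ∈ t, ∑ l ∈ t, G (y + w j) * (starRingEnd ℂ) (G (y + w l)) := by
      intro y
      rw [Complex.ofReal_pow, ← Complex.mul_conj', map_sum, Finset.sum_mul_sum]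
    simp only [h2]
    rw [integral_finsetSum _ fun j _ => integrable_finsetSum _ fun l _ => hint j l]
    refine Finset.sum_congr rfl fun j _ => ?_
    rw [integral_finsetSum _ fun l _ => hint j l]
    refine Finset.sum_congr rfl fun l _ => ?_
    rw [← integral_add_right_eq_self (fun y => G (y + (w j - w l)) * (starRingEnd ℂ) (G y)) (w l)]
    congr 1 with y
    rw [add_assoc, add_sub_cancel]
  have h0 : 0 ≤ ∫ y, ‖∑ j ∈ t, G (y + w j)‖ ^ 2 ∂μ := integral_nonneg fun y => by positivity
  rw [← Real.norm_of_nonneg h0, ← Complex.norm_real, h1]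
  exact (norm_sum_le _ _).trans (Finset.sum_le_sum fun j _ => norm_sum_le _ _)

/-- The average of `exp (2 π i (α + s q)) ψ` over `J` equidistant translates in the direction `e`
has small `L²` norm once `|s| ≥ J ^ 2`. -/
theorem exists_translate_average_bound {Y : Type*} [NormedAddCommGroup Y] [NormedSpace ℝ Y]
    [FiniteDimensional ℝ Y] [MeasurableSpace Y] [BorelSpace Y] {μ : Measure Y}
    [μ.IsAddHaarMeasure] {q ψ : Y → ℝ} (hqc : Continuous q) (hψ : ContDiff ℝ ∞ ψ)
    (hc : HasCompactSupport ψ) {e : Y}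
    {Θ : ℝ × Y → ℝ} (hΘ : ContDiff ℝ ∞ Θ) (hq : ∀ τ y, q (y + τ • e) = q y + τ * Θ (τ, y))
    (hne : ∀ y ∈ tsupport ψ, ∃ v, fderiv ℝ Θ (0, y) (0, v) ≠ 0) :
    ∃ r : ℝ, 0 < r ∧ ∃ C : ℝ, 0 ≤ C ∧ ∀ (J : ℕ) (s : ℝ) (α : Y →L[ℝ] ℝ), 1 ≤ J →
      (J : ℝ) ^ 2 ≤ |s| →
      ∫⁻ y, ‖(J : ℂ)⁻¹ * ∑ j ∈ Finset.range J,
        (ψ (y + (r * j / J) • e) : ℂ) *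
          unitExp (α (y + (r * j / J) • e) + s * q (y + (r * j / J) • e))‖ₑ ^ 2 ∂μ ≤
        ENNReal.ofReal (C / J) := by
  obtain ⟨r, hr, C, hC0, hC⟩ := exists_correlation_bound (μ := μ) hψ hc hΘ hq hne
  set M := ∫ y, ψ y * ψ y ∂μ with hM
  have hM0 : 0 ≤ M := integral_nonneg fun y => mul_self_nonneg _
  -- `M` comes from the J diagonal terms and `C / r` from the off-diagonal ones.
  refine ⟨r, hr, M + C / r, by positivity, fun J s α hJ hs => ?_⟩
  have hJ0 : (0 : ℝ) < J := by exact_mod_cast hJ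
  set G : Y → ℂ := fun y => (ψ y : ℂ) * unitExp (α y + s * q y) with hG
  have hψc : Continuous ψ := hψ.continuous
  have hGc : Continuous G := by fun_prop
  have hGs : HasCompactSupport G := (hc.comp_left (g := fun x : ℝ => (x : ℂ)) (by simp)).mul_right
  have hcor : ∀ σ : ℝ, ‖∫ y, G (y + σ • e) * (starRingEnd ℂ) (G y) ∂μ‖ =
      ‖∫ y, unitExp (s * (q (y + σ • e) - q y)) * (ψ (y + σ • e) * ψ y : ℝ) ∂μ‖ := by
    intro σ
    -- The linear phase α contributes only the unimodular constant exp(2πi σα(e)); this is why the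
    -- bound is uniform in α.
    have h1 : ∀ y, G (y + σ • e) * (starRingEnd ℂ) (G y) = unitExp (σ * α e) *
        (unitExp (s * (q (y + σ • e) - q y)) * (ψ (y + σ • e) * ψ y : ℝ)) := by
      intro y
      have h2 : unitExp (α (y + σ • e) + s * q (y + σ • e)) * unitExp (-(α y + s * q y)) =
          unitExp (σ * α e) * unitExp (s * (q (y + σ • e) - q y)) := by
        rw [← unitExp_add, ← unitExp_add]
        congr 1
        simp
        ring
      simp only [hG, map_mul, star_unitExp, Complex.conj_ofReal]
      push_cast
      linear_combination (ψ (y + σ • e) * ψ y : ℂ) * h2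
    simp only [h1]
    rw [integral_const_mul, norm_mul, norm_unitExp, one_mul]
  have hbound : ∀ j ∈ Finset.range J, ∀ l ∈ Finset.range J,
      ‖∫ y, G (y + ((r * j / J) • e - (r * l / J) • e)) * (starRingEnd ℂ) (G y) ∂μ‖ ≤
        (if j = l then M else 0) + C / (r * J) := by
    intro j hj l hl
    rw [← sub_smul, hcor]
    have hCr : 0 ≤ C / (r * J) := by positivity
    split_ifs with hjl
    · subst hjl
      refine le_trans ?_ (le_add_of_nonneg_right hCr)
      refine (norm_integral_le_integral_norm _).trans (le_of_eq ?_)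
      congr 1 with y
      rw [norm_mul, norm_unitExp, one_mul, Complex.norm_real, sub_self, zero_smul, add_zero,
        Real.norm_of_nonneg (mul_self_nonneg _)]
    · rw [zero_add]
      set σ := r * j / J - r * l / J with hσ
      have hσ' : |σ| = r / J * |(j : ℝ) - l| := by
        rw [hσ, ← abs_of_pos (div_pos hr hJ0), ← abs_mul]
        congr 1
        ring
      have hlow : 1 ≤ |(j : ℝ) - l| := by
        have : (1 : ℤ) ≤ |(j : ℤ) - l| := Int.one_le_abs (by omega)
        exact_mod_cast this
      have hup : |(j : ℝ) - l| ≤ J := by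
        have h1 : (j : ℝ) < J := by exact_mod_cast Finset.mem_range.1 hj
        have h2 : (l : ℝ) < J := by exact_mod_cast Finset.mem_range.1 hl
        have h3 : (0 : ℝ) ≤ j := by positivity
        have h4 : (0 : ℝ) ≤ l := by positivity
        rw [abs_le]
        constructor <;> linarith
      have hσr : |σ| ≤ r := by
        rw [hσ']
        calc r / J * |(j : ℝ) - l| ≤ r / J * J := by gcongr
          _ = r := by field_simp
      have hσl : r / J ≤ |σ| := by
        rw [hσ']
        exact le_mul_of_one_le_right (by positivity) hlow
      -- Distinct shifts differ by at least r/J, so |s||σ| ≥ J² · r/J = rJ.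
      rw [le_div_iff₀ (by positivity), mul_comm]
      refine le_trans ?_ (hC s σ hσr)
      refine mul_le_mul_of_nonneg_right ?_ (norm_nonneg _)
      calc r * J = (J : ℝ) ^ 2 * (r / J) := by field_simp
        _ ≤ |s| * |σ| := by gcongr
  have hsum : ∫ y, ‖∑ j ∈ Finset.range J, G (y + (r * j / J) • e)‖ ^ 2 ∂μ ≤
      J * (M + C / r) := by
    refine (integral_norm_sq_sum_translate_le hGc hGs _ _).trans ?_
    refine (Finset.sum_le_sum fun j hj => Finset.sum_le_sum fun l hl => hbound j hj l hl).trans ?_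
    have h1 : ∀ j ∈ Finset.range J, ∑ l ∈ Finset.range J,
        ((if j = l then M else 0) + C / (r * J)) = M + C / r := by
      intro j hj
      rw [Finset.sum_add_distrib, Finset.sum_ite_eq, if_pos hj, Finset.sum_const,
        Finset.card_range, nsmul_eq_mul]
      field_simp
    rw [Finset.sum_congr rfl h1, Finset.sum_const, Finset.card_range, nsmul_eq_mul]
  have hint : Integrable (fun y => ‖∑ j ∈ Finset.range J, G (y + (r * j / J) • e)‖ ^ 2) μ := by
    have h1 : ∀ w : Y, HasCompactSupport fun y => G (y + w) := fun w =>
      hGs.comp_homeomorph (Homeomorph.addRight w)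
    have h2 : HasCompactSupport fun y => ∑ j ∈ Finset.range J, G (y + (r * j / J) • e) := by
      classical
      induction Finset.range J using Finset.induction_on with
      | empty => exact HasCompactSupport.zero
      | insert a t hat ih =>
        simp only [Finset.sum_insert hat]
        exact (h1 _).add ih
    exact Continuous.integrable_of_hasCompactSupport (by fun_prop)
      (h2.comp_left (g := fun z => ‖z‖ ^ 2) (by simp))
  have hconv : ∀ y, ‖(J : ℂ)⁻¹ * ∑ j ∈ Finset.range J, G (y + (r * j / J) • e)‖ₑ ^ 2 =
      ENNReal.ofReal (((J : ℝ) ^ 2)⁻¹ * ‖∑ j ∈ Finset.range J, G (y + (r * j / J) • e)‖ ^ 2) := by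
    intro y
    rw [← ofReal_norm, ← ENNReal.ofReal_pow (norm_nonneg _)]
    congr 1
    rw [norm_mul, mul_pow]
    simp
  change ∫⁻ y, ‖(J : ℂ)⁻¹ * ∑ j ∈ Finset.range J, G (y + (r * j / J) • e)‖ₑ ^ 2 ∂μ ≤ _
  simp only [hconv]
  rw [← ofReal_integral_eq_lintegral_ofReal (hint.const_mul _)
    (Filter.Eventually.of_forall fun y => by positivity), integral_const_mul]
  refine ENNReal.ofReal_le_ofReal ?_
  calc ((J : ℝ) ^ 2)⁻¹ * ∫ y, ‖∑ j ∈ Finset.range J, G (y + (r * j / J) • e)‖ ^ 2 ∂μ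
      ≤ ((J : ℝ) ^ 2)⁻¹ * (J * (M + C / r)) := by gcongr
    _ = (M + C / r) / J := by field_simp

/-! ### The high-frequency part -/

theorem sq_lintegral_mul_le {Z : Type*} [MeasurableSpace Z] {μ : Measure Z} {f g : Z → ENNReal}
    (hf : AEMeasurable f μ) (hg : AEMeasurable g μ) :
    (∫⁻ z, f z * g z ∂μ) ^ 2 ≤ (∫⁻ z, f z ^ 2 ∂μ) * ∫⁻ z, g z ^ 2 ∂μ := by
  have h := ENNReal.lintegral_mul_le_Lp_mul_Lq μ Real.HolderConjugate.two_two hf hg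
  have h2 : ∀ x : ENNReal, (x ^ (1 / 2 : ℝ)) ^ 2 = x := by
    intro x
    rw [← ENNReal.rpow_natCast, ← ENNReal.rpow_mul]
    norm_num
  calc (∫⁻ z, f z * g z ∂μ) ^ 2
      ≤ ((∫⁻ z, f z ^ (2 : ℝ) ∂μ) ^ (1 / 2 : ℝ) * (∫⁻ z, g z ^ (2 : ℝ) ∂μ) ^ (1 / 2 : ℝ)) ^ 2 := by
        gcongr
        simpa using h
    _ = _ := by
        rw [mul_pow, h2, h2]
        simp only [ENNReal.rpow_ofNat]

/-- The part of the frequency side on which the phase `s q` oscillates strongly. -/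
theorem exists_high_frequency_bound {E Y : Type*} [NormedAddCommGroup E] [InnerProductSpace ℝ E]
    [FiniteDimensional ℝ E] [MeasurableSpace E] [BorelSpace E]
    [NormedAddCommGroup Y] [InnerProductSpace ℝ Y]
    [FiniteDimensional ℝ Y] [MeasurableSpace Y] [BorelSpace Y]
    {q ψ : Y → ℝ} (hqc : Continuous q) (hψ : ContDiff ℝ ∞ ψ)
    (hc : HasCompactSupport ψ) (A : Y →L[ℝ] E) (v₀ : E) {e : Y}
    {Θ : ℝ × Y → ℝ} (hΘ : ContDiff ℝ ∞ Θ) (hq : ∀ τ y, q (y + τ • e) = q y + τ * Θ (τ, y))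
    (hne : ∀ y ∈ tsupport ψ, ∃ v, fderiv ℝ Θ (0, y) (0, v) ≠ 0) :
    ∃ C : ENNReal, C ≠ ⊤ ∧ ∀ (U : E × Y → ℂ) (K : Set E) (M : ENNReal) (J : ℕ),
      ContDiff ℝ ∞ U → IsCompact K → (∀ x y, x ∉ K → U (x, y) = 0) →
      (∀ x y (τ : ℝ), U (x, y + τ • e) = U (x, y)) →
      (∀ y, ∫⁻ x, ‖U (x, y)‖ₑ ^ 2 ≤ M) → 1 ≤ J →
      ∫⁻ ξ in {ξ : E | (J : ℝ) ^ 2 ≤ |inner ℝ v₀ ξ|},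
        ‖∫ z : E × Y, U z * ψ z.2 * unitExp (inner ℝ (z.1 + (A z.2 + q z.2 • v₀)) ξ)‖ₑ ^ 2 ≤
        C * (J : ENNReal)⁻¹ * M := by
  obtain ⟨r, hr, C, hC0, hC⟩ :=
    exists_translate_average_bound (μ := (volume : Measure Y)) hqc hψ hc hΘ hq hne
  -- A compact set containing the supports of all the translates of ψ that are averaged.
  set B : Set Y := (fun p : ℝ × Y => p.2 - p.1 • e) '' (Set.Icc 0 r ×ˢ tsupport ψ) with hB
  have hBc : IsCompact B := (isCompact_Icc.prod hc.isCompact).image (by fun_prop)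
  have hψc : Continuous ψ := hψ.continuous
  refine ⟨ENNReal.ofReal C * volume B, ENNReal.mul_ne_top ENNReal.ofReal_ne_top
    hBc.measure_ne_top, fun U K M J hU hK hUK hUe hUM hJ => ?_⟩
  have hUc : Continuous U := hU.continuous
  have hJ0 : (0 : ℝ) < J := by exact_mod_cast hJ
  set u : Y × E → ℂ := fun p => ∫ x, U (x, p.1) * unitExp (inner ℝ x p.2) with hu
  have hum : StronglyMeasurable u := by
    have h1 : StronglyMeasurable fun p : (Y × E) × E =>
        U (p.2, p.1.1) * unitExp (inner ℝ p.2 p.1.2) :=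
      Continuous.stronglyMeasurable (by fun_prop)
    exact h1.integral_prod_right
  have hue : ∀ y ξ (τ : ℝ), u (y + τ • e, ξ) = u (y, ξ) := fun y ξ τ => by
    simp only [hu, hUe]
  set G : E → Y → ℂ := fun ξ y => ψ y * unitExp (inner ℝ (A y) ξ + inner ℝ v₀ ξ * q y) with hG
  set 𝒢 : E → Y → ℂ := fun ξ y =>
    (J : ℂ)⁻¹ * ∑ j ∈ Finset.range J, G ξ (y + (r * j / J) • e) with h𝒢
  have hGc : ∀ ξ, Continuous (G ξ) := fun ξ => by fun_prop
  have h𝒢c : ∀ ξ, Continuous (𝒢 ξ) := fun ξ => by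
    have := hGc ξ
    fun_prop
  have h𝒢B : ∀ ξ y, y ∉ B → 𝒢 ξ y = 0 := by
    intro ξ y hy
    refine mul_eq_zero_of_right _ (Finset.sum_eq_zero fun j hj => ?_)
    by_contra h
    apply hy
    have h1 : y + (r * j / J) • e ∈ tsupport ψ := subset_tsupport ψ fun h0 => h (by simp [hG, h0])
    have hjJ : (j : ℝ) < J := by exact_mod_cast Finset.mem_range.1 hj
    refine ⟨(r * j / J, y + (r * j / J) • e), ⟨⟨by positivity, ?_⟩, h1⟩, by simp⟩
    rw [div_le_iff₀ hJ0]
    gcongr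
  -- Translating y along e leaves `u` fixed, so `G` can be replaced by its mean `𝒢`.
  have hP : ∀ ξ, ∫ z : E × Y, U z * ψ z.2 *
      unitExp (inner ℝ (z.1 + (A z.2 + q z.2 • v₀)) ξ) = ∫ y, u (y, ξ) * 𝒢 ξ y := by
    intro ξ
    have hint : Integrable (fun z : E × Y => U z * ψ z.2 *
        unitExp (inner ℝ (z.1 + (A z.2 + q z.2 • v₀)) ξ)) (volume.prod volume) := by
      refine Continuous.integrable_of_hasCompactSupport (by fun_prop) ?_
      refine HasCompactSupport.intro (hK.prod hc.isCompact) fun z hz => ?_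
      by_cases h1 : z.1 ∈ K
      · have h2 : ψ z.2 = 0 := image_eq_zero_of_notMem_tsupport fun h2 => hz ⟨h1, h2⟩
        simp [h2]
      · rw [hUK z.1 z.2 h1]
        simp
    have hslice : ∀ y, ∫ x, U (x, y) * ψ y *
        unitExp (inner ℝ (x + (A y + q y • v₀)) ξ) = u (y, ξ) * G ξ y := by
      intro y
      rw [hu, ← integral_mul_const]
      congr 1 with x
      rw [inner_add_left, unitExp_add, inner_add_left, real_inner_smul_left, mul_comm (q y)]
      simp only [hG]
      ring
    have huG : Integrable fun y => u (y, ξ) * G ξ y := by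
      have := hint.integral_prod_right
      simpa only [hslice] using this
    have hshift : ∀ τ : ℝ, Integrable fun y => u (y, ξ) * G ξ (y + τ • e) := by
      intro τ
      have := huG.comp_add_right (τ • e)
      simpa only [hue] using this
    have hshift' : ∀ τ : ℝ, ∫ y, u (y, ξ) * G ξ (y + τ • e) = ∫ y, u (y, ξ) * G ξ y := by
      intro τ
      rw [← integral_add_right_eq_self (fun y => u (y, ξ) * G ξ y) (τ • e)]
      simp only [hue]
    rw [Measure.volume_eq_prod, integral_prod_symm _ hint]
    simp only [hslice]
    have h1 : ∀ y, u (y, ξ) * 𝒢 ξ y =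
        (J : ℂ)⁻¹ * ∑ j ∈ Finset.range J, u (y, ξ) * G ξ (y + (r * j / J) • e) := by
      intro y
      rw [h𝒢, ← Finset.mul_sum]
      ring
    simp only [h1]
    rw [integral_const_mul, integral_finsetSum _ fun j _ => hshift _]
    simp only [hshift']
    rw [Finset.sum_const, Finset.card_range, nsmul_eq_mul, inv_mul_cancel_left₀]
    exact_mod_cast hJ0.ne'
  have hPle : ∀ ξ ∈ {ξ : E | (J : ℝ) ^ 2 ≤ |inner ℝ v₀ ξ|},
      ‖∫ z : E × Y, U z * ψ z.2 * unitExp (inner ℝ (z.1 + (A z.2 + q z.2 • v₀)) ξ)‖ₑ ^ 2 ≤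
        (∫⁻ y in B, ‖u (y, ξ)‖ₑ ^ 2) * ENNReal.ofReal (C / J) := by
    intro ξ hξ
    have hα := hC J (inner ℝ v₀ ξ) ((innerSL ℝ ξ).comp A) hJ hξ
    have hα' : ∫⁻ y, ‖𝒢 ξ y‖ₑ ^ 2 ≤ ENNReal.ofReal (C / J) := by
      simpa only [h𝒢, hG, ContinuousLinearMap.comp_apply, innerSL_apply_apply,
        real_inner_comm ξ] using hα
    rw [hP]
    have hun : Measurable fun y => ‖u (y, ξ)‖ₑ :=
      (hum.comp_measurable (measurable_id.prodMk measurable_const)).enorm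
    calc ‖∫ y, u (y, ξ) * 𝒢 ξ y‖ₑ ^ 2
        = ‖∫ y in B, u (y, ξ) * 𝒢 ξ y‖ₑ ^ 2 := by
          rw [setIntegral_eq_integral_of_forall_compl_eq_zero fun y hy => by
            rw [h𝒢B ξ y hy, mul_zero]]
      _ ≤ (∫⁻ y in B, ‖u (y, ξ)‖ₑ * ‖𝒢 ξ y‖ₑ) ^ 2 := by
          gcongr
          refine (enorm_integral_le_lintegral_enorm _).trans (le_of_eq ?_)
          simp only [enorm_mul]
      _ ≤ (∫⁻ y in B, ‖u (y, ξ)‖ₑ ^ 2) * ∫⁻ y in B, ‖𝒢 ξ y‖ₑ ^ 2 :=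
          sq_lintegral_mul_le hun.aemeasurable (h𝒢c ξ).enorm.measurable.aemeasurable
      _ ≤ _ := by
          gcongr
          exact (setLIntegral_le_lintegral _ _).trans hα'
  have hS : MeasurableSet {ξ : E | (J : ℝ) ^ 2 ≤ |inner ℝ v₀ ξ|} :=
    (isClosed_le continuous_const (by fun_prop)).measurableSet
  have hplanch : ∀ y, ∫⁻ ξ, ‖u (y, ξ)‖ₑ ^ 2 ≤ M := by
    intro y
    have h1 : ContDiff ℝ ∞ fun x => U (x, y) := hU.comp (contDiff_id.prodMk contDiff_const)
    have h2 : HasCompactSupport fun x => U (x, y) :=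
      HasCompactSupport.intro hK fun x hx => hUK x y hx
    have h3 : ∀ ξ, u (y, ξ) = 𝓕 (fun x => U (x, y)) (-ξ) := by
      intro ξ
      rw [Real.fourier_eq]
      simp only [hu]
      congr 1 with x
      rw [Circle.smul_def, coe_fourierChar_eq_unitExp, smul_eq_mul, mul_comm, inner_neg_right,
        neg_neg]
    simp only [h3]
    rw [lintegral_neg_eq_self (fun ξ => ‖𝓕 (fun x => U (x, y)) ξ‖ₑ ^ 2),
      lintegral_enorm_sq_fourier h1 h2]
    exact hUM y
  have hum2 : Measurable fun p : Y × E => ‖u p‖ₑ ^ 2 := hum.enorm.pow_const 2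
  calc _ ≤ ∫⁻ ξ in {ξ : E | (J : ℝ) ^ 2 ≤ |inner ℝ v₀ ξ|},
        (∫⁻ y in B, ‖u (y, ξ)‖ₑ ^ 2) * ENNReal.ofReal (C / J) := setLIntegral_mono' hS hPle
    _ ≤ ∫⁻ ξ, (∫⁻ y in B, ‖u (y, ξ)‖ₑ ^ 2) * ENNReal.ofReal (C / J) :=
        setLIntegral_le_lintegral _ _
    _ = (∫⁻ y in B, ∫⁻ ξ, ‖u (y, ξ)‖ₑ ^ 2) * ENNReal.ofReal (C / J) := by
        rw [lintegral_mul_const' _ _ ENNReal.ofReal_ne_top, lintegral_lintegral_swap]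
        exact (hum2.comp measurable_swap).aemeasurable
    _ ≤ (∫⁻ y in B, M) * ENNReal.ofReal (C / J) := by
        gcongr with y
        exact hplanch y
    _ = _ := by
        rw [setLIntegral_const, ENNReal.ofReal_div_of_pos hJ0, ENNReal.ofReal_natCast,
          div_eq_mul_inv]
        ring

/-! ### Decay of the Fourier transform of the oscillating weight -/

theorem fourier_fderiv_apply {Y : Type*} [NormedAddCommGroup Y] [InnerProductSpace ℝ Y]
    [FiniteDimensional ℝ Y] [MeasurableSpace Y] [BorelSpace Y] {G : Y → ℂ}
    (hG : ContDiff ℝ ∞ G) (hc : HasCompactSupport G) (v η : Y) :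
    𝓕 (fun y => fderiv ℝ G y v) η = 2 * Real.pi * Complex.I * (inner ℝ v η : ℝ) * 𝓕 G η := by
  have hd : Continuous (fderiv ℝ G) := hG.continuous_fderiv (by simp)
  have hi : Integrable (fderiv ℝ G) := hd.integrable_of_hasCompactSupport (hc.fderiv ℝ)
  have h1 := congrFun (Real.fourier_fderiv (hG.continuous.integrable_of_hasCompactSupport hc)
    (hG.differentiable (by simp)) hi) η
  rw [← Real.fourier_continuousLinearMap_apply hi, h1]
  have h2 : innerSL ℝ η v = inner ℝ v η := real_inner_comm v η
  simp [VectorFourier.fourierSMulRight_apply, h2]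
  ring

/-- Decay of the Fourier transform of `exp (2 π i s q) ψ`, polynomially uniform in `s`. -/
theorem exists_fourier_unitExp_mul_bound {Y : Type*} [NormedAddCommGroup Y] [InnerProductSpace ℝ Y]
    [FiniteDimensional ℝ Y] [MeasurableSpace Y] [BorelSpace Y] {q : Y → ℝ}
    (hq : ContDiff ℝ ∞ q) (D : ℕ) {ψ : Y → ℂ} (hψ : ContDiff ℝ ∞ ψ) (hc : HasCompactSupport ψ) :
    ∃ C : ℝ, 0 ≤ C ∧ ∀ (s : ℝ) (η : Y),
      (1 + ‖η‖) ^ D * ‖𝓕 (fun y => unitExp (s * q y) * ψ y) η‖ ≤ C * (1 + |s|) ^ D := by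
  induction D generalizing ψ with
  | zero =>
    refine ⟨∫ y, ‖ψ y‖, integral_nonneg fun y => norm_nonneg _, fun s η => ?_⟩
    rw [pow_zero, pow_zero, one_mul, mul_one, Real.fourier_eq]
    refine (norm_integral_le_integral_norm _).trans (le_of_eq ?_)
    congr 1 with y
    rw [Circle.norm_smul, norm_mul, norm_unitExp, one_mul]
  | succ D ih =>
    let b := stdOrthonormalBasis ℝ Y
    have hq1 : ∀ i, ContDiff ℝ ∞ fun y => ((fderiv ℝ q y (b i) : ℝ) : ℂ) := fun i =>
      Complex.ofRealCLM.contDiff.comp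
        ((hq.fderiv_right (m := ∞) (by simp)).clm_apply contDiff_const)
    -- A derivative of the weight replaces ψ by ∂ψ or by s · ∂q · ψ. The induction is therefore over
    -- all amplitudes, and each power of decay costs one power of 1 + |s|.
    obtain ⟨C0, hC00, hC0⟩ := ih hψ hc
    choose C1 hC10 hC1 using fun i => ih (ψ := fun y => fderiv ℝ ψ y (b i))
      ((hψ.fderiv_right (m := ∞) (by simp)).clm_apply contDiff_const) (hc.fderiv_apply ℝ _)
    choose C2 hC20 hC2 using fun i => ih (ψ := fun y => ((fderiv ℝ q y (b i) : ℝ) : ℂ) * ψ y)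
      ((hq1 i).mul hψ) hc.mul_left
    refine ⟨C0 + ∑ i, (C1 i + C2 i), by
      have := Finset.sum_nonneg fun i (_ : i ∈ Finset.univ) => add_nonneg (hC10 i) (hC20 i)
      positivity, fun s η => ?_⟩
    set g : Y → ℂ := fun y => unitExp (s * q y) * ψ y with hg
    have hu : ContDiff ℝ ∞ fun y => unitExp (s * q y) :=
      contDiff_unitExp.comp (contDiff_const.mul hq)
    have hgC : ContDiff ℝ ∞ g := hu.mul hψ
    have hgc : HasCompactSupport g := hc.mul_left
    have hfd : ∀ i y, fderiv ℝ g y (b i) = unitExp (s * q y) * fderiv ℝ ψ y (b i) +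
        2 * Real.pi * Complex.I * s *
          (unitExp (s * q y) * (((fderiv ℝ q y (b i) : ℝ) : ℂ) * ψ y)) := by
      intro i y
      rw [hg, fderiv_fun_mul (hu.differentiable (by simp) y) (hψ.differentiable (by simp) y)]
      simp only [_root_.add_apply, _root_.smul_apply, smul_eq_mul]
      rw [fderiv_unitExp_comp (((hq.differentiable (by simp)) y).const_mul s),
        fderiv_const_mul (hq.differentiable (by simp) y)]
      simp
      ring
    have hkey : ∀ i, 2 * Real.pi * Complex.I * (inner ℝ (b i) η : ℝ) * 𝓕 g η =
        𝓕 (fun y => unitExp (s * q y) * fderiv ℝ ψ y (b i)) η + 2 * Real.pi * Complex.I * s *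
          𝓕 (fun y => unitExp (s * q y) * (((fderiv ℝ q y (b i) : ℝ) : ℂ) * ψ y)) η := by
      intro i
      rw [← fourier_fderiv_apply hgC hgc]
      simp only [hfd, Real.fourier_eq, smul_add]
      rw [integral_add, ← integral_const_mul]
      · congr 2 with y
        simp only [Circle.smul_def, smul_eq_mul]
        ring
      · rw [Real.fourierIntegral_convergent_iff]
        exact (hu.continuous.mul ((hψ.continuous_fderiv (by simp)).clm_apply
          continuous_const)).integrable_of_hasCompactSupport (hc.fderiv_apply ℝ _).mul_left
      · rw [Real.fourierIntegral_convergent_iff]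
        exact (continuous_const.mul (hu.continuous.mul ((hq1 i).continuous.mul
          hψ.continuous))).integrable_of_hasCompactSupport hc.mul_left.mul_left.mul_left
    have hbd : ∀ i, |inner ℝ (b i) η| * ((1 + ‖η‖) ^ D * ‖𝓕 g η‖) ≤
        (C1 i + C2 i) * (1 + |s|) ^ (D + 1) := by
      intro i
      have h1 := congrArg norm (hkey i)
      have h2 := h1.le.trans (norm_add_le _ _)
      simp only [norm_mul, Complex.norm_real, Complex.norm_I, Complex.norm_ofNat, mul_one,
        Real.norm_eq_abs, abs_of_pos Real.pi_pos] at h2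
      have h3 := hC1 i s η
      have h4 := hC2 i s η
      set a := ‖𝓕 (fun y => unitExp (s * q y) * fderiv ℝ ψ y (b i)) η‖
      set c := ‖𝓕 (fun y => unitExp (s * q y) * (((fderiv ℝ q y (b i) : ℝ) : ℂ) * ψ y)) η‖
      have hpi : 1 ≤ 2 * Real.pi := by linarith [Real.pi_gt_three]
      have ha0 : 0 ≤ a := norm_nonneg _
      have h5 : |inner ℝ (b i) η| * ‖𝓕 g η‖ ≤ a + |s| * c := by
        have h6 : 2 * Real.pi * (|inner ℝ (b i) η| * ‖𝓕 g η‖) ≤ 2 * Real.pi * (a + |s| * c) := by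
          nlinarith
        exact le_of_mul_le_mul_left h6 (by linarith)
      have hs : 0 ≤ |s| := abs_nonneg s
      have hp : 0 ≤ (1 + ‖η‖) ^ D := by positivity
      have hps : 0 ≤ (1 + |s|) ^ D := by positivity
      calc |inner ℝ (b i) η| * ((1 + ‖η‖) ^ D * ‖𝓕 g η‖)
          = (1 + ‖η‖) ^ D * (|inner ℝ (b i) η| * ‖𝓕 g η‖) := by ring
        _ ≤ (1 + ‖η‖) ^ D * (a + |s| * c) := by gcongr
        _ = (1 + ‖η‖) ^ D * a + |s| * ((1 + ‖η‖) ^ D * c) := by ring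
        _ ≤ C1 i * (1 + |s|) ^ D + |s| * (C2 i * (1 + |s|) ^ D) := by gcongr
        _ ≤ (C1 i + C2 i) * (1 + |s|) ^ (D + 1) := by
          have e1 : 0 ≤ C1 i * (1 + |s|) ^ D := mul_nonneg (hC10 i) hps
          have e2 : 0 ≤ C2 i * (1 + |s|) ^ D := mul_nonneg (hC20 i) hps
          rw [pow_succ]
          nlinarith [mul_nonneg hs e1]
    have hη : ‖η‖ ≤ ∑ i, |inner ℝ (b i) η| := by
      conv_lhs => rw [← b.sum_repr' η]
      refine (norm_sum_le _ _).trans (le_of_eq (Finset.sum_congr rfl fun i _ => ?_))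
      rw [norm_smul, b.norm_eq_one, mul_one, Real.norm_eq_abs]
    have hs1 : 1 ≤ 1 + |s| := by linarith [abs_nonneg s]
    calc (1 + ‖η‖) ^ (D + 1) * ‖𝓕 g η‖
        = (1 + ‖η‖) * ((1 + ‖η‖) ^ D * ‖𝓕 g η‖) := by ring
      _ ≤ (1 + ∑ i, |inner ℝ (b i) η|) * ((1 + ‖η‖) ^ D * ‖𝓕 g η‖) := by gcongr
      _ = (1 + ‖η‖) ^ D * ‖𝓕 g η‖ +
          ∑ i, |inner ℝ (b i) η| * ((1 + ‖η‖) ^ D * ‖𝓕 g η‖) := by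
        rw [add_mul, one_mul, Finset.sum_mul]
      _ ≤ C0 * (1 + |s|) ^ (D + 1) + ∑ i, (C1 i + C2 i) * (1 + |s|) ^ (D + 1) := by
        refine add_le_add ((hC0 s η).trans ?_) (Finset.sum_le_sum fun i _ => hbd i)
        gcongr
        omega
      _ = _ := by rw [← Finset.sum_mul, ← add_mul]

/-! ### Linear coordinates adapted to a configuration -/

/-- A complement of range B can be chosen inside range T, and its dimension is that of ker B. Let Z
send ker B isomorphically onto it through T; then B + TZ is injective. -/
theorem exists_bijective_add_comp {E F : Type*} [AddCommGroup E] [Module ℝ E]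
    [FiniteDimensional ℝ E] [AddCommGroup F] [Module ℝ F] (B : E →ₗ[ℝ] E) (T : F →ₗ[ℝ] E)
    (h : LinearMap.range B ⊔ LinearMap.range T = ⊤) :
    ∃ Z : E →ₗ[ℝ] F, Function.Bijective (B + T ∘ₗ Z) := by
  obtain ⟨C', hC'⟩ := Submodule.exists_isCompl (LinearMap.range B ⊓ LinearMap.range T)
  set C := C' ⊓ LinearMap.range T with hC
  have hCT : C ≤ LinearMap.range T := inf_le_right
  have hdisj : Disjoint (LinearMap.range B) C := by
    have h1 : LinearMap.range B ⊓ (C' ⊓ LinearMap.range T) =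
        LinearMap.range B ⊓ LinearMap.range T ⊓ C' := by ac_rfl
    rw [disjoint_iff, hC, h1, hC'.inf_eq_bot]
  have hsup : LinearMap.range B ⊔ C = ⊤ := by
    have h1 : (LinearMap.range B ⊓ LinearMap.range T) ⊔ C = LinearMap.range T := by
      rw [hC, ← sup_inf_assoc_of_le _ inf_le_right, hC'.sup_eq_top, top_inf_eq]
    rw [eq_top_iff, ← h, ← h1]
    exact sup_le le_sup_left (sup_le (inf_le_left.trans le_sup_left) le_sup_right)
  have hrank : Module.finrank ℝ (LinearMap.ker B) = Module.finrank ℝ C := by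
    have h1 := LinearMap.finrank_range_add_finrank_ker B
    have h2 := Submodule.finrank_sup_add_finrank_inf_eq (LinearMap.range B) C
    rw [hsup, disjoint_iff.1 hdisj, finrank_top, finrank_bot] at h2
    omega
  let φ := LinearEquiv.ofFinrankEq (R := ℝ) _ _ hrank
  obtain ⟨π, hπ⟩ := LinearMap.exists_leftInverse_of_injective (LinearMap.ker B).subtype
    (LinearMap.ker_eq_bot.2 (Submodule.subtype_injective _))
  obtain ⟨l, hl⟩ := LinearMap.exists_rightInverse_of_surjective T.rangeRestrict
    T.range_rangeRestrict
  refine ⟨l ∘ₗ Submodule.inclusion hCT ∘ₗ φ.toLinearMap ∘ₗ π, ?_⟩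
  have hT : ∀ x, T (l (Submodule.inclusion hCT (φ (π x)))) = (φ (π x) : E) := fun x =>
    congrArg Subtype.val (LinearMap.congr_fun hl (Submodule.inclusion hCT (φ (π x))))
  have hinj : Function.Injective
      (B + T ∘ₗ l ∘ₗ Submodule.inclusion hCT ∘ₗ φ.toLinearMap ∘ₗ π) := by
    rw [← LinearMap.ker_eq_bot, LinearMap.ker_eq_bot']
    intro x hx
    have hx' : B x + (φ (π x) : E) = 0 := by rw [← hT]; exact hx
    have h1 : B x = ((-φ (π x) : C) : E) := by
      rw [Submodule.coe_neg]
      exact eq_neg_of_add_eq_zero_left hx'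
    have h2 : B x = 0 := Submodule.disjoint_def.1 hdisj _ ⟨x, rfl⟩ (h1 ▸ (-φ (π x)).2)
    rw [h2, zero_add] at hx'
    have h3 : π x = 0 := by simpa using hx'
    have h4 := LinearMap.congr_fun hπ ⟨x, h2⟩
    have h5 : π x = ⟨x, h2⟩ := h4
    rw [h3] at h5
    exact (congrArg Subtype.val h5).symm
  exact ⟨hinj, LinearMap.injective_iff_surjective.1 hinj⟩

/-- A section of a surjection onto `E^ι` along which a further map is invertible in each block. -/
theorem exists_section_bijective {V E ι : Type*} [AddCommGroup V] [Module ℝ V] [AddCommGroup E]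
    [Module ℝ E] [FiniteDimensional ℝ E] [Fintype ι] [DecidableEq ι] (l : V →ₗ[ℝ] (ι → E))
    (m : V →ₗ[ℝ] E) (hl : Function.Surjective l)
    (hm : ∀ i w, ∃ v, m v = w ∧ ∀ j, j ≠ i → l v j = 0) :
    ∃ S : (ι → E) →ₗ[ℝ] V, (∀ X, l (S X) = X) ∧
      ∀ i, Function.Bijective (m ∘ₗ S ∘ₗ LinearMap.single ℝ (fun _ => E) i) := by
  obtain ⟨S₀, hS₀⟩ := LinearMap.exists_rightInverse_of_surjective l (LinearMap.range_eq_top.2 hl)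
  have hS₀' : ∀ X, l (S₀ X) = X := fun X => LinearMap.congr_fun hS₀ X
  have hex : ∀ i, ∃ Z : E →ₗ[ℝ] LinearMap.ker l, Function.Bijective
      (m ∘ₗ S₀ ∘ₗ LinearMap.single ℝ (fun _ => E) i + (m ∘ₗ (LinearMap.ker l).subtype) ∘ₗ Z) := by
    -- Changing the section by a map into ker l keeps it a section. A vector with prescribed image
    -- under `m` and with l concentrated in block i differs from the section by an element of ker l,
    -- so the two ranges span.
    intro i
    refine exists_bijective_add_comp _ _ (eq_top_iff.2 fun w _ => ?_)
    obtain ⟨v, rfl, hv⟩ := hm i w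
    have hker : v - S₀ (Pi.single i (l v i)) ∈ LinearMap.ker l := by
      rw [LinearMap.mem_ker, map_sub, hS₀', sub_eq_zero]
      funext j
      by_cases hj : j = i
      · subst hj
        simp
      · rw [hv j hj, Pi.single_eq_of_ne hj]
    refine Submodule.mem_sup.2 ⟨_, ⟨l v i, rfl⟩, _, ⟨⟨_, hker⟩, rfl⟩, ?_⟩
    simp
  choose Z hZ using hex
  refine ⟨S₀ + ∑ i, (LinearMap.ker l).subtype ∘ₗ Z i ∘ₗ LinearMap.proj i, fun X => ?_, fun i => ?_⟩
  · simp [hS₀']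
  · convert hZ i using 2
    ext x
    simp [Pi.single_apply, apply_ite]

/-- The section supplies the first coordinates, and a basis of ker l the remaining ones. -/
theorem exists_coordinates {V E ι : Type*} [AddCommGroup V] [Module ℝ V] [FiniteDimensional ℝ V]
    [AddCommGroup E]
    [Module ℝ E] [FiniteDimensional ℝ E] [Fintype ι] [DecidableEq ι] (l : V →ₗ[ℝ] (ι → E))
    (m : V →ₗ[ℝ] E) (hl : Function.Surjective l)
    (hm : ∀ i w, ∃ v, m v = w ∧ ∀ j, j ≠ i → l v j = 0) :
    ∃ (d : ℕ) (Φ : ((ι → E) × (Fin d → ℝ)) ≃ₗ[ℝ] V), (∀ p, l (Φ p) = p.1) ∧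
      ∀ i, Function.Bijective fun x => m (Φ (Pi.single i x, 0)) := by
  obtain ⟨S, hS, hSm⟩ := exists_section_bijective l m hl hm
  let κ := (Module.finBasis ℝ (LinearMap.ker l)).equivFun.symm
  have hκ : ∀ t, l (κ t) = 0 := fun t => (κ t).2
  let Ψ : ((ι → E) × (Fin (Module.finrank ℝ (LinearMap.ker l)) → ℝ)) →ₗ[ℝ] V :=
    S.coprod ((LinearMap.ker l).subtype ∘ₗ κ.toLinearMap)
  have hΨ : ∀ p, Ψ p = S p.1 + κ p.2 := fun p => rfl
  have hlΨ : ∀ p, l (Ψ p) = p.1 := fun p => by rw [hΨ, map_add, hS, hκ, add_zero]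
  have hbij : Function.Bijective Ψ := by
    constructor
    · rw [← LinearMap.ker_eq_bot, LinearMap.ker_eq_bot']
      intro p hp
      have h1 : p.1 = 0 := by rw [← hlΨ, hp, map_zero]
      have h2 : p.2 = 0 := by
        rw [hΨ, h1, map_zero, zero_add] at hp
        simpa using hp
      exact Prod.ext h1 h2
    · intro v
      have hker : v - S (l v) ∈ LinearMap.ker l := by
        rw [LinearMap.mem_ker, map_sub, hS, sub_self]
      refine ⟨(l v, κ.symm ⟨_, hker⟩), ?_⟩
      rw [hΨ]
      simp
  refine ⟨_, LinearEquiv.ofBijective Ψ hbij, hlΨ, fun i => ?_⟩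
  convert hSm i using 1
  funext x
  simp [hΨ]

/-! ### The low-frequency part -/

/-- Three factors leave two besides j. Cauchy-Schwarz is applied to these two, and every other
factor, including the j-th, is bounded pointwise. -/
theorem lintegral_prod_le_of_three_le_card {Z ι : Type*} [MeasurableSpace Z] {μ : Measure Z}
    [Fintype ι] [DecidableEq ι] (hι : 3 ≤ Fintype.card ι) {g : ι → Z → ENNReal}
    (hg : ∀ i, AEMeasurable (g i) μ) (j : ι) {M : ι → ENNReal} {K : ENNReal}
    (hM : ∀ i z, g i z ≤ M i) (hL : ∀ i, i ≠ j → ∫⁻ z, g i z ^ 2 ∂μ ≤ K * M i ^ 2) :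
    ∫⁻ z, ∏ i, g i z ∂μ ≤ K * ∏ i, M i := by
  obtain ⟨a, ha⟩ : ∃ a, a ∈ (Finset.univ.erase j : Finset ι) := by
    refine Finset.card_pos.1 ?_
    rw [Finset.card_erase_of_mem (Finset.mem_univ j), Finset.card_univ]
    omega
  obtain ⟨b, hb⟩ : ∃ b, b ∈ ((Finset.univ.erase j).erase a : Finset ι) := by
    refine Finset.card_pos.1 ?_
    rw [Finset.card_erase_of_mem ha, Finset.card_erase_of_mem (Finset.mem_univ j),
      Finset.card_univ]
    omega
  have hab : b ≠ a := Finset.ne_of_mem_erase hb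
  have haj : a ≠ j := Finset.ne_of_mem_erase ha
  have hbj : b ≠ j := Finset.ne_of_mem_erase (Finset.mem_of_mem_erase hb)
  have hbm : b ∈ (Finset.univ.erase a : Finset ι) := Finset.mem_erase.2 ⟨hab, Finset.mem_univ b⟩
  have hsplit : ∀ x : ι → ENNReal,
      ∏ i, x i = x a * x b * ∏ i ∈ (Finset.univ.erase a).erase b, x i := by
    intro x
    rw [mul_assoc, Finset.mul_prod_erase _ _ hbm, Finset.mul_prod_erase _ _ (Finset.mem_univ a)]
  have hcs : ∫⁻ z, g a z * g b z ∂μ ≤ K * (M a * M b) := by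
    have h := sq_lintegral_mul_le (hg a) (hg b)
    have h2 : (∫⁻ z, g a z * g b z ∂μ) ^ 2 ≤ (K * (M a * M b)) ^ 2 := by
      refine h.trans ((mul_le_mul' (hL a haj) (hL b hbj)).trans (le_of_eq ?_))
      ring
    exact (ENNReal.pow_le_pow_left_iff two_ne_zero).1 h2
  calc ∫⁻ z, ∏ i, g i z ∂μ
      ≤ ∫⁻ z, g a z * g b z * ∏ i ∈ (Finset.univ.erase a).erase b, M i ∂μ := by
        refine lintegral_mono fun z => ?_
        rw [hsplit]
        gcongr with i
        exact hM i z
    _ = (∫⁻ z, g a z * g b z ∂μ) * ∏ i ∈ (Finset.univ.erase a).erase b, M i :=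
        lintegral_mul_const'' _ ((hg a).mul (hg b))
    _ ≤ K * (M a * M b) * ∏ i ∈ (Finset.univ.erase a).erase b, M i := by gcongr
    _ = K * ∏ i, M i := by rw [hsplit M]; ring

/-- Uniqueness of Haar measure; the point is that `K` depends on neither the translation nor the
integrand. -/
theorem exists_lintegral_comp_affine {E : Type*} [NormedAddCommGroup E] [NormedSpace ℝ E]
    [FiniteDimensional ℝ E] [MeasurableSpace E] [BorelSpace E] {μ : Measure E}
    [μ.IsAddHaarMeasure] {L : E →L[ℝ] E} (hL : Function.Bijective L) :
    ∃ K : ENNReal, K ≠ ⊤ ∧ ∀ (φ : E → ENNReal) (c : E), Measurable φ →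
      ∫⁻ x, φ (L x + c) ∂μ = K * ∫⁻ x, φ x ∂μ := by
  let e : E ≃L[ℝ] E := (LinearEquiv.ofBijective (L : E →ₗ[ℝ] E) hL).toContinuousLinearEquiv
  have he : ∀ x, e x = L x := fun x => rfl
  have h : μ.map e = ((μ.map e).addHaarScalarFactor μ : ENNReal) • μ :=
    Measure.isAddLeftInvariant_eq_smul _ _
  refine ⟨(μ.map e).addHaarScalarFactor μ, ENNReal.coe_ne_top, fun φ c hφ => ?_⟩
  have hφ' : Measurable fun y => φ (y + c) := hφ.comp (measurable_id.add_const c)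
  have h1 := lintegral_map (μ := μ) hφ' e.continuous.measurable
  rw [h, lintegral_smul_measure, lintegral_add_right_eq_self φ c, smul_eq_mul] at h1
  simpa only [he] using h1.symm

/-- A product of functions of separate variables, paired with a character composed with an affine
map, is a product of Fourier transforms. -/
theorem norm_integral_prod_mul_unitExp {E ι : Type*} [NormedAddCommGroup E]
    [InnerProductSpace ℝ E] [FiniteDimensional ℝ E] [MeasurableSpace E] [BorelSpace E] [Fintype ι]
    (f : ι → E → ℂ) (c : ℝ) (w : ι → E) :
    ‖∫ X : ι → E, (∏ i, f i (X i)) * unitExp (∑ i, inner ℝ (X i) (w i) + c)‖ₑ =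
      ∏ i, ‖𝓕 (f i) (-w i)‖ₑ := by
  have h1 : ∀ X : ι → E, (∏ i, f i (X i)) * unitExp (∑ i, inner ℝ (X i) (w i) + c) =
      (∏ i, f i (X i) * unitExp (inner ℝ (X i) (w i))) * unitExp c := by
    intro X
    have h2 : unitExp (∑ i, inner ℝ (X i) (w i)) = ∏ i, unitExp (inner ℝ (X i) (w i)) := by
      simp only [unitExp]
      rw [← Complex.exp_sum]
      push_cast
      rw [Finset.mul_sum, Finset.sum_mul]
    rw [unitExp_add, h2, Finset.prod_mul_distrib, mul_assoc]
  simp only [h1]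
  rw [integral_mul_const, enorm_mul, enorm_unitExp, mul_one,
    integral_fintype_prod_volume_eq_prod (fun i x => f i x * unitExp (inner ℝ x (w i)))]
  rw [← ofReal_norm, norm_prod, ENNReal.ofReal_prod_of_nonneg fun i _ => norm_nonneg _]
  refine Finset.prod_congr rfl fun i _ => ?_
  rw [ofReal_norm, Real.fourier_eq]
  congr 2 with x
  rw [Circle.smul_def, coe_fourierChar_eq_unitExp, smul_eq_mul, mul_comm, inner_neg_right,
    neg_neg]

section LowFrequency

variable {E Y ι : Type*} [NormedAddCommGroup E] [InnerProductSpace ℝ E]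
  [NormedAddCommGroup Y] [InnerProductSpace ℝ Y] [Fintype ι] [DecidableEq ι] {d : ℕ}

/-- The block of `m ∘ Φ` in the coordinate `i`. -/
noncomputable def coordBlock {G : Type*} [NormedAddCommGroup G] [NormedSpace ℝ G]
    (Φ : ((ι → E) × (Fin d → ℝ)) ≃L[ℝ] (E × Y)) (m : E × Y →L[ℝ] G) (i : ι) : E →L[ℝ] G :=
  m ∘L (Φ : ((ι → E) × (Fin d → ℝ)) →L[ℝ] (E × Y)) ∘L
    ContinuousLinearMap.inl ℝ (ι → E) (Fin d → ℝ) ∘L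
    ContinuousLinearMap.single ℝ (fun _ : ι => E) i

theorem apply_eq_sum_coordBlock {G : Type*} [NormedAddCommGroup G] [NormedSpace ℝ G]
    (Φ : ((ι → E) × (Fin d → ℝ)) ≃L[ℝ] (E × Y)) (m : E × Y →L[ℝ] G) (X : ι → E)
    (t : Fin d → ℝ) :
    m (Φ (X, t)) = ∑ i, coordBlock Φ m i (X i) + m (Φ (0, t)) := by
  have h1 : (X, t) = ∑ i, ((Pi.single i (X i) : ι → E), (0 : Fin d → ℝ)) + (0, t) := by
    refine Prod.ext ?_ ?_
    · simp [Prod.fst_sum, Finset.univ_sum_single]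
    · simp [Prod.snd_sum]
  rw [h1, map_add, map_add, map_sum, map_sum]
  rfl

variable [FiniteDimensional ℝ E] [MeasurableSpace E] [BorelSpace E]
  [FiniteDimensional ℝ Y] [MeasurableSpace Y] [BorelSpace Y]

/-- The frequency at which the `i`-th function is evaluated. -/
noncomputable def coordFrequency (Φ : ((ι → E) × (Fin d → ℝ)) ≃L[ℝ] (E × Y)) (m : E × Y →L[ℝ] E) (i : ι)
    (ξ : E) (η : Y) : E :=
  (coordBlock Φ m i).adjoint ξ + (coordBlock Φ (ContinuousLinearMap.snd ℝ E Y) i).adjoint η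

/-- Once G is expanded by Fourier inversion, the phase is linear in X and the integral over X
factors into Fourier transforms of the f_i. The coordinate t enters only through a unimodular
constant. -/
theorem enorm_integral_fiber_le (Φ : ((ι → E) × (Fin d → ℝ)) ≃L[ℝ] (E × Y))
    (m : E × Y →L[ℝ] E) {f : ι → E → ℂ} (hf : ∀ i, Continuous (f i))
    (hc : ∀ i, HasCompactSupport (f i)) {G : Y → ℂ} (hG : ContDiff ℝ ∞ G)
    (hGc : HasCompactSupport G) (ξ : E) (t : Fin d → ℝ) :
    ‖∫ X : ι → E, (∏ i, f i (X i)) * unitExp (inner ℝ (m (Φ (X, t))) ξ) * G (Φ (X, t)).2‖ₑ ≤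
      ∫⁻ η, ‖𝓕 G η‖ₑ * ∏ i, ‖𝓕 (f i) (-coordFrequency Φ m i ξ η)‖ₑ := by
  have hprod : Continuous fun X : ι → E => ∏ i, f i (X i) :=
    continuous_finsetProd _ fun i _ => (hf i).comp (continuous_apply i)
  have hW : Integrable fun X : ι → E =>
      (∏ i, f i (X i)) * unitExp (inner ℝ (m (Φ (X, t))) ξ) := by
    refine Continuous.integrable_of_hasCompactSupport (hprod.mul (by fun_prop)) ?_
    refine HasCompactSupport.intro (isCompact_univ_pi fun i => (hc i).isCompact) fun X hX => ?_
    rw [Set.mem_univ_pi, not_forall] at hX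
    obtain ⟨i, hi⟩ := hX
    rw [Finset.prod_eq_zero (Finset.mem_univ i)
      (image_eq_zero_of_notMem_tsupport (f := f i) hi), zero_mul]
  rw [integral_mul_comp_eq_integral_fourier hG hGc hW
    (φ := fun X => (Φ (X, t)).2) (by fun_prop : Continuous _).measurable]
  refine (enorm_integral_le_lintegral_enorm _).trans (lintegral_mono fun η => ?_)
  rw [enorm_mul]
  refine mul_le_mul_right (le_of_eq ?_) _
  rw [← norm_integral_prod_mul_unitExp f
    (inner ℝ (m (Φ (0, t))) ξ + inner ℝ (Φ (0, t)).2 η)]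
  congr 2 with X
  rw [mul_assoc, ← unitExp_add]
  congr 2
  have h2 := apply_eq_sum_coordBlock Φ (ContinuousLinearMap.snd ℝ E Y) X t
  simp only [ContinuousLinearMap.coe_snd'] at h2
  rw [apply_eq_sum_coordBlock Φ m X t, h2, inner_add_left, inner_add_left, sum_inner, sum_inner]
  simp only [coordFrequency, inner_add_right, ContinuousLinearMap.adjoint_inner_right,
    Finset.sum_add_distrib]
  ring

/-- The fibre bound does not depend on t, and only t in a fixed compact set contributes, so
integrating in t costs a constant. Compactness uses that the point x is itself one of the
coordinates, the one with index `i₀`. -/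
theorem exists_enorm_integral_le (Φ : ((ι → E) × (Fin d → ℝ)) ≃L[ℝ] (E × Y))
    (m : E × Y →L[ℝ] E) {i₀ : ι} (hΦ : ∀ p, (Φ p).1 = p.1 i₀) {K : Set E} (hK : IsCompact K)
    {q ψ : Y → ℝ} (hq : ContDiff ℝ ∞ q) (hψ : ContDiff ℝ ∞ ψ) (hψc : HasCompactSupport ψ) :
    ∃ C : ENNReal, C ≠ ⊤ ∧ ∀ (f : ι → E → ℂ) (U : E × Y → ℂ), (∀ i, ContDiff ℝ ∞ (f i)) →
      (∀ i, tsupport (f i) ⊆ K) → Continuous U → (∀ p, U (Φ p) = ∏ i, f i (p.1 i)) →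
      ∀ (s : ℝ) (ξ : E),
      ‖∫ z, U z * ψ z.2 * unitExp (inner ℝ (m z) ξ + s * q z.2)‖ₑ ≤
        C * ∫⁻ η, ‖𝓕 (fun y => unitExp (s * q y) * (ψ y : ℂ)) η‖ₑ *
          ∏ i, ‖𝓕 (f i) (-coordFrequency Φ m i ξ η)‖ₑ := by
  set R : Set (Fin d → ℝ) := (fun z => (Φ.symm z).2) '' (K ×ˢ tsupport ψ) with hR
  have hRc : IsCompact R := (hK.prod hψc.isCompact).image (by fun_prop)
  have : (volume : Measure ((ι → E) × (Fin d → ℝ))).IsAddHaarMeasure :=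
    Measure.prod.instIsAddHaarMeasure _ _
  have : (volume : Measure (E × Y)).IsAddHaarMeasure := Measure.prod.instIsAddHaarMeasure _ _
  set ν := (volume : Measure (E × Y)).map Φ.symm with hν
  have : ν.IsAddHaarMeasure := Φ.symm.isAddHaarMeasure_map _
  have hνc : ν = ((ν.addHaarScalarFactor volume : NNReal) : ENNReal) • volume :=
    Measure.isAddLeftInvariant_eq_smul _ _
  set κ : NNReal := ν.addHaarScalarFactor volume
  refine ⟨κ * volume R, ENNReal.mul_ne_top ENNReal.coe_ne_top hRc.measure_ne_top,
    fun f U hf hfK hUc hU s ξ => ?_⟩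
  have hqc := hq.continuous
  have hψ0 := hψ.continuous
  have hfc : ∀ i, HasCompactSupport (f i) := fun i =>
    hK.of_isClosed_subset (isClosed_tsupport _) (hfK i)
  set G : Y → ℂ := fun y => unitExp (s * q y) * (ψ y : ℂ) with hG
  have hGC : ContDiff ℝ ∞ G := (contDiff_unitExp.comp (contDiff_const.mul hq)).mul
    (Complex.ofRealCLM.contDiff.comp hψ)
  have hGc : HasCompactSupport G :=
    (hψc.comp_left (g := fun x : ℝ => (x : ℂ)) (by simp)).mul_left
  set I := ∫⁻ η, ‖𝓕 G η‖ₑ * ∏ i, ‖𝓕 (f i) (-coordFrequency Φ m i ξ η)‖ₑ with hI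
  set H : E × Y → ℂ := fun z => U z * ψ z.2 * unitExp (inner ℝ (m z) ξ + s * q z.2) with hH
  have hHc : Continuous H := by fun_prop
  have hH0 : ∀ z, z ∉ K ×ˢ tsupport ψ → H z = 0 := by
    intro z hz
    by_cases h1 : z.2 ∈ tsupport ψ
    · have h2 : z.1 ∉ K := fun h => hz ⟨h, h1⟩
      have h3 : U z = 0 := by
        rw [← Φ.apply_symm_apply z, hU]
        refine Finset.prod_eq_zero (Finset.mem_univ i₀) (image_eq_zero_of_notMem_tsupport ?_)
        rw [← hΦ, Φ.apply_symm_apply]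
        exact fun h => h2 (hfK i₀ h)
      simp [hH, h3]
    · simp [hH, image_eq_zero_of_notMem_tsupport h1]
  have hHs : HasCompactSupport H := HasCompactSupport.intro (hK.prod hψc.isCompact) hH0
  have hint : Integrable (fun p => H (Φ p)) (volume.prod volume) :=
    Continuous.integrable_of_hasCompactSupport (hHc.comp Φ.continuous)
      (hHs.comp_homeomorph Φ.toHomeomorph)
  have hchange : ∫ z, H z = (κ : ℝ) • ∫ p, H (Φ p) := by
    have h1 : ∫ p, H (Φ p) ∂ν = ∫ z, H z := by
      have h2 := integral_map_equiv (μ := (volume : Measure (E × Y)))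
        Φ.symm.toHomeomorph.toMeasurableEquiv (fun p => H (Φ p))
      refine h2.trans ?_
      congr 1 with z
      exact congrArg H (Φ.apply_symm_apply z)
    rw [← h1, hνc, integral_smul_measure]
    rfl
  have hfib : ∀ t, ∫ X, H (Φ (X, t)) =
      ∫ X : ι → E, (∏ i, f i (X i)) * unitExp (inner ℝ (m (Φ (X, t))) ξ) * G (Φ (X, t)).2 := by
    intro t
    congr 1 with X
    simp only [hH, hG, hU, unitExp_add]
    ring
  have hfib_le : ∀ t, ‖∫ X, H (Φ (X, t))‖ₑ ≤ R.indicator (fun _ => I) t := by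
    intro t
    by_cases ht : t ∈ R
    · rw [Set.indicator_of_mem ht, hfib]
      exact enorm_integral_fiber_le Φ m (fun i => (hf i).continuous) hfc hGC hGc ξ t
    · have h1 : ∀ X, H (Φ (X, t)) = 0 := fun X => hH0 _ fun h => ht
        ⟨Φ (X, t), h, by simp⟩
      simp [h1]
  rw [hchange, Measure.volume_eq_prod, integral_prod_symm _ hint, enorm_smul]
  calc _ ≤ (κ : ENNReal) * ∫⁻ t, R.indicator (fun _ => I) t := by
        refine mul_le_mul' (le_of_eq ?_)
          ((enorm_integral_le_lintegral_enorm _).trans (lintegral_mono hfib_le))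
        rw [Real.enorm_eq_ofReal κ.coe_nonneg, ENNReal.ofReal_coe_nnreal]
    _ = κ * volume R * I := by
        rw [lintegral_indicator_const hRc.measurableSet]
        ring

end LowFrequency

theorem bijective_neg_adjoint {E : Type*} [NormedAddCommGroup E] [InnerProductSpace ℝ E]
    [FiniteDimensional ℝ E] {B : E →L[ℝ] E} (hB : Function.Bijective B) :
    Function.Bijective (-B.adjoint) := by
  have hinj : Function.Injective (-B.adjoint) := by
    rw [injective_iff_map_eq_zero]
    intro x hx
    obtain ⟨w, rfl⟩ := hB.2 x
    have h1 : B.adjoint (B w) = 0 := by simpa using hx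
    have h2 : inner ℝ (B w) (B w) = 0 := by
      rw [← ContinuousLinearMap.adjoint_inner_right, h1, inner_zero_right]
    exact inner_self_eq_zero.1 h2
  exact ⟨hinj, LinearMap.injective_iff_surjective (f := ((-B.adjoint : E →L[ℝ] E) : E →ₗ[ℝ] E)).1
    hinj⟩

/-- The part of the frequency side on which the phase `s q` oscillates at most like `J ^ 2`. -/
theorem exists_low_frequency_bound {E Y : Type*} [NormedAddCommGroup E] [InnerProductSpace ℝ E]
    [FiniteDimensional ℝ E] [MeasurableSpace E] [BorelSpace E]
    [NormedAddCommGroup Y] [InnerProductSpace ℝ Y]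
    [FiniteDimensional ℝ Y] [MeasurableSpace Y] [BorelSpace Y] {k d : ℕ} (hk : 2 ≤ k)
    (Φ : ((Fin k → E) × (Fin d → ℝ)) ≃L[ℝ] (E × Y))
    (m : E × Y →L[ℝ] E) (hm : ∀ i, Function.Bijective (coordBlock Φ m i)) (v₀ : E)
    {i₀ : Fin k} (hΦ : ∀ p, (Φ p).1 = p.1 i₀) {K : Set E} (hK : IsCompact K)
    {q ψ : Y → ℝ} (hq : ContDiff ℝ ∞ q) (hψ : ContDiff ℝ ∞ ψ) (hψc : HasCompactSupport ψ) :
    ∃ C : ENNReal, C ≠ ⊤ ∧ ∀ (f : Fin (k + 1) → E → ℂ) (U : E × Y → ℂ) (j : Fin (k + 1))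
      (M : Fin (k + 1) → ENNReal) (J : ℕ), (∀ i, ContDiff ℝ ∞ (f i)) →
      (∀ i, tsupport (f i) ⊆ K) → Continuous U →
      (∀ p, U (Φ p) = ∏ i : Fin k, f i.castSucc (p.1 i)) →
      (∀ i ξ, ‖𝓕 (f i) ξ‖ₑ ≤ M i) → (∀ i, i ≠ j → ∫⁻ ξ, ‖𝓕 (f i) ξ‖ₑ ^ 2 ≤ M i ^ 2) → 1 ≤ J →
      ∫⁻ ξ in {ξ : E | (J : ℝ) ^ 2 ≤ |inner ℝ v₀ ξ|}ᶜ, ‖𝓕 (f (Fin.last k)) ξ‖ₑ *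
        ‖∫ z, U z * ψ z.2 * unitExp (inner ℝ (m z) ξ + inner ℝ v₀ ξ * q z.2)‖ₑ ≤
        C * (J : ENNReal) ^ (2 * (Module.finrank ℝ Y + 1)) * ∏ i, M i := by
  -- The least integer D for which (1 + |η|)^(-D) is integrable.
  set D := Module.finrank ℝ Y + 1 with hD
  obtain ⟨C₁, hC₁, hP⟩ := exists_enorm_integral_le Φ m hΦ hK hq hψ hψc
  obtain ⟨C₂, hC₂0, hC₂⟩ := exists_fourier_unitExp_mul_bound hq D
    (ψ := fun y => (ψ y : ℂ)) (Complex.ofRealCLM.contDiff.comp hψ)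
    (hψc.comp_left (g := fun x : ℝ => (x : ℂ)) (by simp))
  choose κ hκ hκ' using fun i => exists_lintegral_comp_affine (μ := (volume : Measure E))
    (bijective_neg_adjoint (hm i))
  set w : Y → ENNReal := fun η => ENNReal.ofReal ((1 + ‖η‖) ^ (-(D : ℝ))) with hw
  have hwm : Measurable w := by fun_prop
  have hwfin : ∫⁻ η, w η ≠ ⊤ := by
    refine (finite_integral_one_add_norm (μ := (volume : Measure Y)) (r := (D : ℝ)) ?_).ne
    rw [hD]
    exact_mod_cast Nat.lt_succ_self _
  -- Dominates 1, needed for the last function, and every Jacobian constant `κ i`, needed for the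
  -- others.
  set L : ENNReal := 1 + ∑ i, κ i with hL
  have hLfin : L ≠ ⊤ := ENNReal.add_ne_top.2 ⟨ENNReal.one_ne_top,
    ENNReal.sum_ne_top.2 fun i _ => hκ i⟩
  refine ⟨C₁ * ENNReal.ofReal (C₂ * 2 ^ D) * ((∫⁻ η, w η) * L), by finiteness,
    fun f U j M J hf hfK hUc hU hM hM2 hJ => ?_⟩
  have hJ1 : (1 : ℝ) ≤ J := by exact_mod_cast hJ
  have hfc : ∀ i, HasCompactSupport (f i) := fun i =>
    hK.of_isClosed_subset (isClosed_tsupport _) (hfK i)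
  have hFc : ∀ i, Continuous (𝓕 (f i)) := fun i => continuous_fourier (hf i) (hfc i)
  have hFr : ∀ i, Continuous fun p : E × Y => coordFrequency Φ m i p.1 p.2 := fun i => by
    unfold coordFrequency
    fun_prop
  obtain ⟨g, hglast, hgcast⟩ : ∃ g : Y → Fin (k + 1) → E → ENNReal,
      (∀ η ξ, g η (Fin.last k) ξ = ‖𝓕 (f (Fin.last k)) ξ‖ₑ) ∧
      ∀ η (i : Fin k) ξ, g η i.castSucc ξ =
        ‖𝓕 (f i.castSucc) (-coordFrequency Φ m i ξ η)‖ₑ :=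
    ⟨fun η => Fin.snoc (α := fun _ => E → ENNReal)
      (fun i ξ => ‖𝓕 (f i.castSucc) (-coordFrequency Φ m i ξ η)‖ₑ)
      (fun ξ => ‖𝓕 (f (Fin.last k)) ξ‖ₑ), fun η ξ => by beta_reduce; rw [Fin.snoc_last],
      fun η i ξ => by beta_reduce; rw [Fin.snoc_castSucc]⟩
  have hgm : ∀ i, Measurable fun p : E × Y => g p.2 i p.1 := by
    intro i
    induction i using Fin.lastCases with
    | last =>
      simp only [hglast]
      exact ((hFc _).comp continuous_fst).enorm.measurable
    | cast i =>
      simp only [hgcast]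
      exact ((hFc _).comp (hFr i).neg).enorm.measurable
  have hgm' : ∀ η i, Measurable (g η i) := fun η i =>
    (hgm i).comp (measurable_id.prodMk measurable_const)
  have hprod : ∀ ξ η, ‖𝓕 (f (Fin.last k)) ξ‖ₑ *
      ∏ i : Fin k, ‖𝓕 (f i.castSucc) (-coordFrequency Φ m i ξ η)‖ₑ = ∏ i, g η i ξ := by
    intro ξ η
    rw [Fin.prod_univ_castSucc, hglast, mul_comm]
    simp only [hgcast]
  have hinner : ∀ η, ∫⁻ ξ, ∏ i, g η i ξ ≤ L * ∏ i, M i := by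
    intro η
    refine lintegral_prod_le_of_three_le_card (by simpa using hk)
      (fun i => (hgm' η i).aemeasurable) j (fun i ξ => ?_) (fun i hi => ?_)
    · induction i using Fin.lastCases with
      | last => rw [hglast]; exact hM _ _
      | cast i => rw [hgcast]; exact hM _ _
    · induction i using Fin.lastCases with
      | last =>
        simp only [hglast]
        refine (hM2 _ hi).trans (le_mul_of_one_le_left zero_le le_self_add)
      | cast i =>
        simp only [hgcast]
        have h1 : ∀ ξ, -coordFrequency Φ m i ξ η = (-(coordBlock Φ m i).adjoint) ξ +
            -((coordBlock Φ (ContinuousLinearMap.snd ℝ E Y) i).adjoint η) := by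
          intro ξ
          rw [coordFrequency, neg_add, _root_.neg_apply]
        simp only [h1]
        rw [hκ' i (fun x => ‖𝓕 (f i.castSucc) x‖ₑ ^ 2) _ ((hFc _).enorm.measurable.pow_const 2)]
        gcongr
        · exact (Finset.single_le_sum (fun _ _ => zero_le) (Finset.mem_univ i)).trans le_add_self
        · exact hM2 _ hi
  have hdecay : ∀ ξ ∈ {ξ : E | (J : ℝ) ^ 2 ≤ |inner ℝ v₀ ξ|}ᶜ, ∀ η,
      ‖𝓕 (fun y => unitExp (inner ℝ v₀ ξ * q y) * (ψ y : ℂ)) η‖ₑ ≤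
        ENNReal.ofReal (C₂ * 2 ^ D) * (J : ENNReal) ^ (2 * D) * w η := by
    intro ξ hξ η
    have hs : |inner ℝ v₀ ξ| ≤ (J : ℝ) ^ 2 :=
      (not_le.1 (show ¬(J : ℝ) ^ 2 ≤ |inner ℝ v₀ ξ| from hξ)).le
    have h1 := hC₂ (inner ℝ v₀ ξ) η
    have hη : 0 < 1 + ‖η‖ := by positivity
    -- On this region |s| ≤ J² and J ≥ 1, so 1 + |s| ≤ 2J².
    have h2 : (1 + |inner ℝ v₀ ξ|) ^ D ≤ 2 ^ D * (J : ℝ) ^ (2 * D) := by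
      rw [pow_mul, ← mul_pow]
      gcongr
      nlinarith
    rw [← ofReal_norm, ← ENNReal.ofReal_natCast, ← ENNReal.ofReal_pow (by positivity),
      ← ENNReal.ofReal_mul (by positivity), hw, ← ENNReal.ofReal_mul (by positivity)]
    refine ENNReal.ofReal_le_ofReal ?_
    rw [Real.rpow_neg hη.le, Real.rpow_natCast, ← div_eq_mul_inv, le_div_iff₀ (by positivity),
      mul_comm]
    calc _ ≤ C₂ * (1 + |inner ℝ v₀ ξ|) ^ D := h1
      _ ≤ C₂ * (2 ^ D * (J : ℝ) ^ (2 * D)) := by gcongr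
      _ = _ := by ring
  have hS : MeasurableSet {ξ : E | (J : ℝ) ^ 2 ≤ |inner ℝ v₀ ξ|} :=
    (isClosed_le continuous_const (by fun_prop)).measurableSet
  set c : ENNReal := C₁ * (ENNReal.ofReal (C₂ * 2 ^ D) * (J : ENNReal) ^ (2 * D)) with hc
  have hcfin : c ≠ ⊤ := by finiteness
  have hpm : Measurable fun p : E × Y => w p.2 * ∏ i, g p.2 i p.1 :=
    (hwm.comp measurable_snd).mul (Finset.measurable_prod _ fun i _ => hgm i)
  have hpoint : ∀ ξ ∈ {ξ : E | (J : ℝ) ^ 2 ≤ |inner ℝ v₀ ξ|}ᶜ, ‖𝓕 (f (Fin.last k)) ξ‖ₑ *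
        ‖∫ z, U z * ψ z.2 * unitExp (inner ℝ (m z) ξ + inner ℝ v₀ ξ * q z.2)‖ₑ ≤
      c * ∫⁻ η, w η * ∏ i, g η i ξ := by
    intro ξ hξ
    have h1 := hP (fun i => f i.castSucc) U (fun i => hf _) (fun i => hfK _) hUc hU
      (inner ℝ v₀ ξ) ξ
    calc _ ≤ ‖𝓕 (f (Fin.last k)) ξ‖ₑ * (C₁ * ∫⁻ η,
          ENNReal.ofReal (C₂ * 2 ^ D) * (J : ENNReal) ^ (2 * D) * w η *
            ∏ i : Fin k, ‖𝓕 (f i.castSucc) (-coordFrequency Φ m i ξ η)‖ₑ) := by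
          gcongr
          refine h1.trans ?_
          gcongr with η
          exact hdecay ξ hξ η
      _ = c * ∫⁻ η, w η * ∏ i, g η i ξ := by
          simp only [← hprod]
          have h2 : ∀ η, w η * (‖𝓕 (f (Fin.last k)) ξ‖ₑ *
              ∏ i : Fin k, ‖𝓕 (f i.castSucc) (-coordFrequency Φ m i ξ η)‖ₑ) =
              ‖𝓕 (f (Fin.last k)) ξ‖ₑ * (w η *
              ∏ i : Fin k, ‖𝓕 (f i.castSucc) (-coordFrequency Φ m i ξ η)‖ₑ) := fun η => by ring
          simp only [h2, mul_assoc (ENNReal.ofReal (C₂ * 2 ^ D) * (J : ENNReal) ^ (2 * D))]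
          rw [lintegral_const_mul' _ _ (by finiteness), lintegral_const_mul' _ _ enorm_ne_top]
          ring
  calc _ ≤ ∫⁻ ξ in {ξ : E | (J : ℝ) ^ 2 ≤ |inner ℝ v₀ ξ|}ᶜ, c * ∫⁻ η, w η * ∏ i, g η i ξ :=
        setLIntegral_mono' hS.compl hpoint
    _ ≤ ∫⁻ ξ, c * ∫⁻ η, w η * ∏ i, g η i ξ := setLIntegral_le_lintegral _ _
    _ = c * ∫⁻ η, w η * ∫⁻ ξ, ∏ i, g η i ξ := by
        rw [lintegral_const_mul' _ _ hcfin, lintegral_lintegral_swap hpm.aemeasurable]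
        congr 2 with η
        exact lintegral_const_mul' _ _ ENNReal.ofReal_ne_top
    _ ≤ c * ∫⁻ η, w η * (L * ∏ i, M i) := by
        gcongr with η
        exact hinner η
    _ = _ := by
        rw [lintegral_mul_const _ hwm]
        ring

/-! ### Combining the two frequency regions -/

theorem lintegral_enorm_pow_le_of_tsupport_subset {E : Type*} [TopologicalSpace E]
    [MeasurableSpace E] {μ : Measure E} {K : Set E} (hK1 : μ K ≤ 1) {g : E → ℂ}
    (hg : ∀ x, x ∉ K → g x = 0) {N : ENNReal} (hN : ∀ x, ‖g x‖ₑ ≤ N)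
    {p : ℕ} (hp : p ≠ 0) : ∫⁻ x, ‖g x‖ₑ ^ p ∂μ ≤ N ^ p := by
  have h1 : ∫⁻ x in K, ‖g x‖ₑ ^ p ∂μ = ∫⁻ x, ‖g x‖ₑ ^ p ∂μ := by
    refine setLIntegral_eq_of_support_subset fun x hx => ?_
    by_contra h
    exact hx (by simp [hg x h, hp])
  rw [← h1]
  calc ∫⁻ x in K, ‖g x‖ₑ ^ p ∂μ ≤ ∫⁻ _ in K, N ^ p ∂μ := by
        gcongr with x
        exact hN x
    _ ≤ N ^ p := by
        rw [setLIntegral_const]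
        exact mul_le_of_le_one_right zero_le hK1

theorem enorm_fourier_le_lintegral {E : Type*} [NormedAddCommGroup E] [InnerProductSpace ℝ E]
    [FiniteDimensional ℝ E] [MeasurableSpace E] [BorelSpace E] (f : E → ℂ) (ξ : E) :
    ‖𝓕 f ξ‖ₑ ≤ ∫⁻ x, ‖f x‖ₑ := by
  rw [Real.fourier_eq]
  refine (enorm_integral_le_lintegral_enorm _).trans (le_of_eq ?_)
  congr 1 with x
  rw [← ofReal_norm, Circle.norm_smul, ofReal_norm]

/-- The configuration form is controlled by the Fourier transform of any one of the functions, up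
to an error that can be made small. -/
theorem exists_configuration_bound {E Y : Type*} [NormedAddCommGroup E] [InnerProductSpace ℝ E]
    [FiniteDimensional ℝ E] [MeasurableSpace E] [BorelSpace E]
    [NormedAddCommGroup Y] [InnerProductSpace ℝ Y]
    [FiniteDimensional ℝ Y] [MeasurableSpace Y] [BorelSpace Y] {k d : ℕ} (hk : 2 ≤ k)
    {A : Fin k → Y →L[ℝ] E} {i₀ : Fin k} (hA : A i₀ = 0) (B : Y →L[ℝ] E) (v₀ : E)
    {Φ : ((Fin k → E) × (Fin d → ℝ)) ≃L[ℝ] (E × Y)}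
    (hΦ : ∀ p i, (Φ p).1 + A i (Φ p).2 = p.1 i)
    (hB : ∀ i, Function.Bijective fun x : E =>
      (Φ (Pi.single i x, 0)).1 + B (Φ (Pi.single i x, 0)).2)
    {K : Set E} (hK : IsCompact K) (hK1 : volume K ≤ 1)
    {q ψ : Y → ℝ} (hq : ContDiff ℝ ∞ q) (hψ : ContDiff ℝ ∞ ψ) (hψc : HasCompactSupport ψ)
    {e : Y} (he : ∀ i, A i e = 0) {Θ : ℝ × Y → ℝ} (hΘ : ContDiff ℝ ∞ Θ)
    (hqΘ : ∀ τ y, q (y + τ • e) = q y + τ * Θ (τ, y))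
    (hne : ∀ y ∈ tsupport ψ, ∃ v, fderiv ℝ Θ (0, y) (0, v) ≠ 0) :
    ∃ C : ENNReal, C ≠ ⊤ ∧ ∀ (f : Fin (k + 1) → E → ℂ) (N : Fin (k + 1) → ENNReal)
      (j : Fin (k + 1)) (ρ : ENNReal) (I : ℕ), (∀ i, ContDiff ℝ ∞ (f i)) →
      (∀ i, tsupport (f i) ⊆ K) → (∀ i x, ‖f i x‖ₑ ≤ N i) → (∀ ξ, ‖𝓕 (f j) ξ‖ₑ ≤ ρ) → 1 ≤ I →
      ‖∫ z : E × Y, (∏ i : Fin k, f i.castSucc (z.1 + A i z.2)) * ψ z.2 *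
        f (Fin.last k) (z.1 + (B z.2 + q z.2 • v₀))‖ₑ ≤
        C * ((I : ENNReal)⁻¹ * ∏ i, N i + (I : ENNReal) ^ (4 * (Module.finrank ℝ Y + 1)) *
          ∏ i, Function.update N j ρ i) := by
  obtain ⟨C₁, hC₁, hhigh⟩ :=
    exists_high_frequency_bound hq.continuous hψ hψc B v₀ hΘ hqΘ hne
  set m : E × Y →L[ℝ] E := ContinuousLinearMap.fst ℝ E Y + B ∘L ContinuousLinearMap.snd ℝ E Y
    with hm
  have hmz : ∀ z, m z = z.1 + B z.2 := fun z => rfl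
  obtain ⟨C₂, hC₂, hlow⟩ := exists_low_frequency_bound hk Φ m hB v₀ (i₀ := i₀)
    (fun p => by simpa [hA] using hΦ p i₀) hK hq hψ hψc
  refine ⟨(C₁ + 1) + C₂, by finiteness, fun f N j ρ I hf hfK hN hρ hI => ?_⟩
  set U : E × Y → ℂ := fun z => ∏ i : Fin k, f i.castSucc (z.1 + A i z.2) with hU
  have hUs : ContDiff ℝ ∞ U := contDiff_prod fun i _ => (hf _).comp
    (contDiff_fst.add ((A i).contDiff.comp contDiff_snd))
  have hU0 : ∀ x y, x ∉ K → U (x, y) = 0 := by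
    intro x y hx
    refine Finset.prod_eq_zero (Finset.mem_univ i₀) (image_eq_zero_of_notMem_tsupport fun h => ?_)
    apply hx
    simpa [hA] using hfK _ h
  have hUe : ∀ x y (τ : ℝ), U (x, y + τ • e) = U (x, y) := by
    intro x y τ
    simp [hU, he]
  have hUN : ∀ z, ‖U z‖ₑ ≤ ∏ i : Fin k, N i.castSucc := by
    intro z
    rw [hU, ← ofReal_norm, norm_prod, ENNReal.ofReal_prod_of_nonneg fun i _ => norm_nonneg _]
    refine Finset.prod_le_prod' fun i _ => ?_
    rw [ofReal_norm]
    exact hN _ _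
  have hUΦ : ∀ p, U (Φ p) = ∏ i : Fin k, f i.castSucc (p.1 i) := fun p => by
    simp only [hU, hΦ]
  have hUM : ∀ y, ∫⁻ x, ‖U (x, y)‖ₑ ^ 2 ≤ (∏ i : Fin k, N i.castSucc) ^ 2 := fun y =>
    lintegral_enorm_pow_le_of_tsupport_subset hK1 (fun x hx => hU0 x y hx) (fun x => hUN _)
      two_ne_zero
  have hfc : ∀ i, HasCompactSupport (f i) := fun i =>
    hK.of_isClosed_subset (isClosed_tsupport _) (hfK i)
  have hf0 : ∀ i x, x ∉ K → f i x = 0 := fun i x hx =>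
    image_eq_zero_of_notMem_tsupport fun h => hx (hfK i h)
  have hF2 : ∀ i, ∫⁻ ξ, ‖𝓕 (f i) ξ‖ₑ ^ 2 ≤ N i ^ 2 := fun i => by
    rw [lintegral_enorm_sq_fourier (hf i) (hfc i)]
    exact lintegral_enorm_pow_le_of_tsupport_subset hK1 (hf0 i) (hN i) two_ne_zero
  have hF1 : ∀ i ξ, ‖𝓕 (f i) ξ‖ₑ ≤ N i := fun i ξ => by
    refine (enorm_fourier_le_lintegral _ _).trans ?_
    simpa using lintegral_enorm_pow_le_of_tsupport_subset hK1 (hf0 i) (hN i) one_ne_zero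
  -- With J = I² the square root in Cauchy-Schwarz turns J⁻¹ into I⁻¹.
  have hJ : 1 ≤ I ^ 2 := Nat.one_le_pow _ _ hI
  have hqc := hq.continuous
  have hψ0 := hψ.continuous
  have hUc := hUs.continuous
  have hW : Integrable fun z : E × Y => U z * ψ z.2 := by
    have : (volume : Measure (E × Y)).IsAddHaarMeasure := Measure.prod.instIsAddHaarMeasure _ _
    refine Continuous.integrable_of_hasCompactSupport (by fun_prop) ?_
    refine HasCompactSupport.intro (hK.prod hψc.isCompact) fun z hz => ?_
    by_cases h1 : z.1 ∈ K
    · have h2 : ψ z.2 = 0 := image_eq_zero_of_notMem_tsupport fun h2 => hz ⟨h1, h2⟩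
      simp [h2]
    · rw [show U z = 0 from hU0 z.1 z.2 h1, zero_mul]
  set P : E → ℂ := fun ξ =>
    ∫ z, U z * ψ z.2 * unitExp (inner ℝ (z.1 + (B z.2 + q z.2 • v₀)) ξ) with hP
  have hPm : StronglyMeasurable P := by
    have h1 : StronglyMeasurable fun p : E × (E × Y) =>
        U p.2 * ψ p.2.2 * unitExp (inner ℝ (p.2.1 + (B p.2.2 + q p.2.2 • v₀)) p.1) :=
      Continuous.stronglyMeasurable (by fun_prop)
    exact h1.integral_prod_right
  have hP' : ∀ ξ, P ξ = ∫ z, U z * ψ z.2 * unitExp (inner ℝ (m z) ξ + inner ℝ v₀ ξ * q z.2) := by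
    intro ξ
    rw [hP]
    refine integral_congr_ae (Filter.Eventually.of_forall fun z => ?_)
    beta_reduce
    rw [hmz, ← add_assoc, inner_add_left, real_inner_smul_left, mul_comm (q z.2)]
  set S : Set E := {ξ : E | ((I ^ 2 : ℕ) : ℝ) ^ 2 ≤ |inner ℝ v₀ ξ|} with hS
  have hSm : MeasurableSet S := (isClosed_le continuous_const (by fun_prop)).measurableSet
  have hFm : Measurable fun ξ => ‖𝓕 (f (Fin.last k)) ξ‖ₑ :=
    (continuous_fourier (hf _) (hfc _)).enorm.measurable
  have hI0 : (I : ENNReal) ≠ 0 := by exact_mod_cast (by omega : I ≠ 0)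
  have h_high : ∫⁻ ξ in S, ‖𝓕 (f (Fin.last k)) ξ‖ₑ * ‖P ξ‖ₑ ≤
      (C₁ + 1) * ((I : ENNReal)⁻¹ * ∏ i, N i) := by
    have h1 := hhigh U K _ (I ^ 2) hUs hK hU0 hUe hUM hJ
    have h2 : ∫⁻ ξ in S, ‖𝓕 (f (Fin.last k)) ξ‖ₑ ^ 2 ≤ N (Fin.last k) ^ 2 :=
      (setLIntegral_le_lintegral _ _).trans (hF2 _)
    have h3 := (sq_lintegral_mul_le (μ := volume.restrict S) hFm.aemeasurable
      hPm.enorm.aemeasurable).trans (mul_le_mul' h2 h1)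
    refine (ENNReal.pow_le_pow_left_iff two_ne_zero).1 (h3.trans ?_)
    -- Avoids a square root of `C₁` when squares are compared.
    have h4 : C₁ ≤ (C₁ + 1) ^ 2 := by
      rw [sq]
      exact le_self_add.trans (le_mul_of_one_le_right zero_le le_add_self)
    rw [Fin.prod_univ_castSucc, Nat.cast_pow, ENNReal.inv_pow]
    calc _ ≤ N (Fin.last k) ^ 2 * ((C₁ + 1) ^ 2 * ((I : ENNReal)⁻¹) ^ 2 *
          (∏ i : Fin k, N i.castSucc) ^ 2) := by gcongr
      _ = _ := by ring
  have h_low : ∫⁻ ξ in Sᶜ, ‖𝓕 (f (Fin.last k)) ξ‖ₑ * ‖P ξ‖ₑ ≤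
      C₂ * ((I : ENNReal) ^ (4 * (Module.finrank ℝ Y + 1)) *
        ∏ i, Function.update N j ρ i) := by
    have h1 := hlow f U j (Function.update N j ρ) (I ^ 2) hf hfK hUc hUΦ (fun i ξ => ?_)
      (fun i hi => ?_) hJ
    · simp only [hP']
      refine h1.trans (le_of_eq ?_)
      rw [Nat.cast_pow, ← pow_mul, mul_assoc]
      congr 3
      ring
    · by_cases hi : i = j
      · subst hi
        rw [Function.update_self]
        exact hρ ξ
      · rw [Function.update_of_ne hi]
        exact hF1 i ξ
    · rw [Function.update_of_ne hi]
      exact hF2 i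
  rw [integral_mul_comp_eq_integral_fourier (hf _) (hfc _) hW
    (φ := fun z => z.1 + (B z.2 + q z.2 • v₀)) (by fun_prop : Continuous _).measurable]
  calc _ ≤ ∫⁻ ξ, ‖𝓕 (f (Fin.last k)) ξ‖ₑ * ‖P ξ‖ₑ := by
        refine (enorm_integral_le_lintegral_enorm _).trans (le_of_eq ?_)
        simp only [enorm_mul, hP]
    _ = (∫⁻ ξ in S, ‖𝓕 (f (Fin.last k)) ξ‖ₑ * ‖P ξ‖ₑ) +
        ∫⁻ ξ in Sᶜ, ‖𝓕 (f (Fin.last k)) ξ‖ₑ * ‖P ξ‖ₑ := (lintegral_add_compl _ hSm).symm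
    _ ≤ (C₁ + 1) * ((I : ENNReal)⁻¹ * ∏ i, N i) +
        C₂ * ((I : ENNReal) ^ (4 * (Module.finrank ℝ Y + 1)) *
        ∏ i, Function.update N j ρ i) := add_le_add h_high h_low
    _ ≤ _ := by
        rw [mul_add (C₁ + 1 + C₂)]
        exact add_le_add (mul_le_mul' le_self_add le_rfl) (mul_le_mul' le_add_self le_rfl)

/-! ### Consequences of non-degeneracy -/

theorem exists_transpose_mulVec_eq_of_rank_eq_card {a b : Type*} [Fintype a] [Fintype b]
    [DecidableEq b] (M : Matrix a b ℝ) (hM : M.rank = Fintype.card b) (t : b → ℝ) :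
    ∃ y : a → ℝ, Mᵀ *ᵥ y = t := by
  rw [← Matrix.rank_transpose, Matrix.rank] at hM
  have h : LinearMap.range Mᵀ.mulVecLin = ⊤ :=
    Submodule.eq_top_of_finrank_eq (by rw [hM, Module.finrank_fintype_fun_eq_card])
  obtain ⟨y, hy⟩ := LinearMap.range_eq_top.1 h t
  exact ⟨y, hy⟩

/-- The linear map `y ↦ M y` between Euclidean spaces. -/
noncomputable def matrixCLM {n m : ℕ} (M : Matrix (Fin n) (Fin m) ℝ) :
    EuclideanSpace ℝ (Fin m) →L[ℝ] EuclideanSpace ℝ (Fin n) :=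
  LinearMap.toContinuousLinearMap (Matrix.toEuclideanLin M)

theorem matrixCLM_apply {n m : ℕ} (M : Matrix (Fin n) (Fin m) ℝ) (y : EuclideanSpace ℝ (Fin m)) :
    matrixCLM M y = WithLp.toLp 2 (M *ᵥ fun i => y i) := rfl

theorem card_ne_prod {k n : ℕ} (j : Fin k) :
    Fintype.card ({i : Fin k // i ≠ j} × Fin n) = (k - 1) * n := by
  rw [Fintype.card_prod, Fintype.card_fin, Fintype.card_subtype_compl, Fintype.card_fin,
    Fintype.card_unique]

/-- Full column rank of the first block matrix makes its transpose, y ↦ (A_i y) for i ≠ j,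
surjective. -/
theorem NonDegenerateSystem.exists_apply_eq {n m k : ℕ} {A : Fin k → Matrix (Fin n) (Fin m) ℝ}
    (hA : NonDegenerateSystem A) (j : Fin k) (w : Fin k → EuclideanSpace ℝ (Fin n)) :
    ∃ y, ∀ i, i ≠ j → matrixCLM (A i) y = w i := by
  obtain ⟨y, hy⟩ := exists_transpose_mulVec_eq_of_rank_eq_card _
    ((hA j).1.trans (card_ne_prod j).symm) fun p => w p.1 p.2
  refine ⟨WithLp.toLp 2 y, fun i hi => ?_⟩
  ext c
  exact congrFun hy (⟨i, hi⟩, c)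

/-- The same for the second block matrix and the differences; it is what handles the point x itself.
-/
theorem NonDegenerateSystem.exists_sub_apply_eq {n m k : ℕ}
    {A : Fin k → Matrix (Fin n) (Fin m) ℝ}
    (hA : NonDegenerateSystem A) (j : Fin k) (w : Fin k → EuclideanSpace ℝ (Fin n)) :
    ∃ y, ∀ i, i ≠ j → matrixCLM (A i) y - matrixCLM (A j) y = w i := by
  obtain ⟨y, hy⟩ := exists_transpose_mulVec_eq_of_rank_eq_card _
    ((hA j).2.trans (card_ne_prod j).symm) fun p => w p.1 p.2
  refine ⟨WithLp.toLp 2 y, fun i hi => ?_⟩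
  ext c
  refine Eq.trans ?_ (congrFun hy (⟨i, hi⟩, c))
  change (A i *ᵥ y) c - (A j *ᵥ y) c = ∑ a, (A i c a - A j c a) * y a
  simp only [Matrix.mulVec, dotProduct, sub_mul, Finset.sum_sub_distrib]

/-- Coordinates adapted to a non-degenerate system: the first `k` points of the configuration are
free, and the last one depends invertibly on each of them. -/
theorem NonDegenerateSystem.exists_coordinates {n m k : ℕ}
    {A : Fin (k + 1) → Matrix (Fin n) (Fin m) ℝ} (hA : NonDegenerateSystem A)
    {A' : Fin (k + 1) → EuclideanSpace ℝ (Fin m) →L[ℝ] EuclideanSpace ℝ (Fin n)}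
    (hA0 : A' 0 = 0) (hAs : ∀ j : Fin k, A' j.succ = matrixCLM (A j.castSucc)) :
    ∃ (d : ℕ) (Φ : ((Fin (k + 1) → EuclideanSpace ℝ (Fin n)) × (Fin d → ℝ)) ≃L[ℝ]
        (EuclideanSpace ℝ (Fin n) × EuclideanSpace ℝ (Fin m))),
      (∀ p i, (Φ p).1 + A' i (Φ p).2 = p.1 i) ∧
      ∀ i, Function.Bijective fun x => (Φ (Pi.single i x, 0)).1 +
        matrixCLM (A (Fin.last k)) (Φ (Pi.single i x, 0)).2 := by
  let l : EuclideanSpace ℝ (Fin n) × EuclideanSpace ℝ (Fin m) →ₗ[ℝ]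
      (Fin (k + 1) → EuclideanSpace ℝ (Fin n)) :=
    LinearMap.pi fun i => LinearMap.fst ℝ _ _ + (A' i : _ →ₗ[ℝ] _) ∘ₗ LinearMap.snd ℝ _ _
  let f : EuclideanSpace ℝ (Fin n) × EuclideanSpace ℝ (Fin m) →ₗ[ℝ] EuclideanSpace ℝ (Fin n) :=
    LinearMap.fst ℝ _ _ + (matrixCLM (A (Fin.last k)) : _ →ₗ[ℝ] _) ∘ₗ LinearMap.snd ℝ _ _
  have hl : ∀ z i, l z i = z.1 + A' i z.2 := fun z i => rfl
  have hf : ∀ z, f z = z.1 + matrixCLM (A (Fin.last k)) z.2 := fun z => rfl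
  have hsurj : Function.Surjective l := by
    intro X
    obtain ⟨y, hy⟩ := hA.exists_apply_eq (Fin.last k)
      (Fin.snoc (α := fun _ => EuclideanSpace ℝ (Fin n)) (fun j : Fin k => X j.succ - X 0) 0)
    refine ⟨(X 0, y), funext fun i => ?_⟩
    rw [hl]
    induction i using Fin.cases with
    | zero => simp [hA0]
    | succ j =>
      have h1 := hy j.castSucc (Fin.castSucc_lt_last j).ne
      rw [Fin.snoc_castSucc] at h1
      rw [hAs, h1]
      simp
  have hdep : ∀ i w, ∃ z, f z = w ∧ ∀ j, j ≠ i → l z j = 0 := by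
    intro i w
    induction i using Fin.cases with
    | zero =>
      -- To move only the point x, all other points x + A_j y must be 0 while x + A_k y = w;
      -- subtracting gives A_j y - A_k y = -w.
      obtain ⟨y, hy⟩ := hA.exists_sub_apply_eq (Fin.last k) fun _ => -w
      refine ⟨(w - matrixCLM (A (Fin.last k)) y, y), by simp [hf], fun j hj => ?_⟩
      obtain ⟨j, rfl⟩ := Fin.exists_succ_eq.2 hj
      have h1 := hy j.castSucc (Fin.castSucc_lt_last j).ne
      rw [hl, hAs]
      change w - matrixCLM (A (Fin.last k)) y + matrixCLM (A j.castSucc) y = 0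
      rw [sub_add_eq_add_sub, add_sub_assoc, h1, add_neg_cancel]
    | succ i =>
      -- With x = 0, omit the matrix of the point being moved: the other free matrices kill y and
      -- the last one sends it to w.
      obtain ⟨y, hy⟩ := hA.exists_apply_eq i.castSucc
        (Fin.snoc (α := fun _ => EuclideanSpace ℝ (Fin n)) (fun _ : Fin k => 0) w)
      refine ⟨(0, y), ?_, fun j hj => ?_⟩
      · have h1 := hy (Fin.last k) (Fin.castSucc_lt_last i).ne'
        rw [Fin.snoc_last] at h1
        rw [hf, h1, zero_add]
      · rw [hl, zero_add]
        induction j using Fin.cases with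
        | zero => simp [hA0]
        | succ j =>
          have h1 := hy j.castSucc fun h => hj (congrArg Fin.succ (Fin.castSucc_injective _ h))
          rw [Fin.snoc_castSucc] at h1
          rw [hAs, h1]
  obtain ⟨d, Φ, h1, h2⟩ := _root_.exists_coordinates l f hsurj hdep
  exact ⟨d, Φ.toContinuousLinearEquiv, fun p i => congrFun (h1 p) i, h2⟩

/-- Dimension count: m unknowns against kn equations. This is the direction of translation in the
high-frequency estimate. -/
theorem exists_ne_zero_forall_apply_eq_zero {n m k : ℕ} (hm : k * n < m)
    (A : Fin k → EuclideanSpace ℝ (Fin m) →L[ℝ] EuclideanSpace ℝ (Fin n)) :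
    ∃ e, e ≠ 0 ∧ ∀ i, A i e = 0 := by
  let l : EuclideanSpace ℝ (Fin m) →ₗ[ℝ] (Fin k → EuclideanSpace ℝ (Fin n)) :=
    LinearMap.pi fun i => (A i : _ →ₗ[ℝ] _)
  have h : LinearMap.ker l ≠ ⊥ := LinearMap.ker_ne_bot_of_finrank_lt (by
    rw [Module.finrank_pi_fintype]
    simpa using hm)
  obtain ⟨e, he, he0⟩ := Submodule.exists_mem_ne_zero_of_ne_bot h
  exact ⟨e, he0, fun i => congrFun (LinearMap.mem_ker.1 he) i⟩

/-! ### The unit cube -/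

theorem unitCube_eq_image (n : ℕ) :
    unitCube n = WithLp.toLp 2 '' Set.univ.pi fun _ : Fin n => Set.Icc (-(1 / 2) : ℝ) (1 / 2) := by
  ext x
  simp only [unitCube, Set.mem_ofPred_eq, abs_le]
  constructor
  · exact fun h => ⟨fun i => x i, fun i _ => h i, rfl⟩
  · rintro ⟨y, hy, rfl⟩ i
    exact hy i trivial

theorem isCompact_unitCube (n : ℕ) : IsCompact (unitCube n) := by
  rw [unitCube_eq_image]
  exact (isCompact_univ_pi fun _ => isCompact_Icc).image (PiLp.continuous_toLp 2 _)

theorem volume_unitCube (n : ℕ) : volume (unitCube n) = 1 := by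
  have h := (PiLp.volume_preserving_ofLp (Fin n)).measure_preimage
    (s := Set.univ.pi fun _ : Fin n => Set.Icc (-(1 / 2) : ℝ) (1 / 2))
    (MeasurableSet.univ_pi fun _ => measurableSet_Icc).nullMeasurableSet
  have h2 : WithLp.ofLp ⁻¹' (Set.univ.pi fun _ : Fin n => Set.Icc (-(1 / 2) : ℝ) (1 / 2)) =
      unitCube n := by
    ext x
    simp only [unitCube, Set.mem_preimage, Set.mem_pi, Set.mem_univ, true_implies, Set.mem_Icc,
      Set.mem_ofPred_eq, abs_le]
  rw [← h2, h, volume_pi_pi]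
  simp only [Real.volume_Icc]
  norm_num

/-! ### Optimising the cut-off -/

/-- Taking I near r^(-1/(2a)) gives I⁻¹ ≤ r^(1/(2a)) and I^a r ≲ r^(1/2). Since a ≥ 1, the second is
the smaller power of the two. Exact balancing is not needed. -/
theorem le_mul_rpow_of_forall_nat {Λ P r C : ℝ} {a : ℕ} (ha : 1 ≤ a) (hr0 : 0 ≤ r) (hr1 : r ≤ 1)
    (hC : 0 ≤ C) (hP : 0 ≤ P)
    (h : ∀ I : ℕ, 1 ≤ I → Λ ≤ C * ((I : ℝ)⁻¹ * P + (I : ℝ) ^ a * (r * P))) :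
    Λ ≤ C * (1 + 2 ^ a) * P * r ^ (1 / (2 * a) : ℝ) := by
  have ha0 : (1 : ℝ) ≤ a := by exact_mod_cast ha
  have hδ : 0 < (1 / (2 * a) : ℝ) := by positivity
  rcases hr0.eq_or_lt with rfl | hr
  -- For r = 0 no single I suffices; let I tend to infinity.
  · rw [Real.zero_rpow hδ.ne', mul_zero]
    have hlim : Filter.Tendsto (fun I : ℕ => C * ((I : ℝ)⁻¹ * P + (I : ℝ) ^ a * (0 * P)))
        Filter.atTop (nhds 0) := by
      simpa using (tendsto_inv_atTop_nhds_zero_nat (𝕜 := ℝ)).mul_const P |>.const_mul C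
    exact ge_of_tendsto hlim (Filter.eventually_atTop.2 ⟨1, h⟩)
  · set δ : ℝ := 1 / (2 * a) with hδd
    set t := r ^ (-δ) with ht
    have ht1 : 1 ≤ t := Real.one_le_rpow_of_pos_of_le_one_of_nonpos hr hr1 (by linarith)
    have ht0 : 0 < t := by linarith
    set I := ⌈t⌉₊ with hI
    have hIt : t ≤ I := Nat.le_ceil t
    have hIt2 : (I : ℝ) ≤ 2 * t := by
      have := (Nat.ceil_lt_add_one ht0.le).le
      linarith
    have hI1 : 1 ≤ I := Nat.one_le_ceil_iff.2 ht0
    have htinv : t⁻¹ = r ^ δ := by rw [ht, Real.rpow_neg hr.le, inv_inv]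
    have h1 : (I : ℝ)⁻¹ ≤ r ^ δ := by
      rw [← htinv]
      exact inv_anti₀ ht0 hIt
    have h2 : (I : ℝ) ^ a * r ≤ 2 ^ a * r ^ δ := by
      have e1 : t ^ a * r = r ^ (1 / 2 : ℝ) := by
        rw [ht, ← Real.rpow_natCast, ← Real.rpow_mul hr.le]
        nth_rewrite 2 [← Real.rpow_one r]
        rw [← Real.rpow_add hr]
        congr 1
        rw [hδd]
        field_simp
        norm_num
      calc (I : ℝ) ^ a * r ≤ (2 * t) ^ a * r := by gcongr
        _ = 2 ^ a * (t ^ a * r) := by ring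
        _ ≤ 2 ^ a * r ^ δ := by
          rw [e1]
          refine mul_le_mul_of_nonneg_left ?_ (by positivity)
          refine Real.rpow_le_rpow_of_exponent_ge hr hr1 ?_
          rw [hδd]
          gcongr
          linarith
    calc Λ ≤ C * ((I : ℝ)⁻¹ * P + (I : ℝ) ^ a * (r * P)) := h I hI1
      _ = C * ((I : ℝ)⁻¹ * P + ((I : ℝ) ^ a * r) * P) := by ring
      _ ≤ C * (r ^ δ * P + (2 ^ a * r ^ δ) * P) := by gcongr
      _ = _ := by ring

/-- Optimisation in the cut-off and averaging over the distinguished index. -/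
theorem le_prod_rpow_of_forall_update {ι : Type*} [Fintype ι] [DecidableEq ι] [Nonempty ι]
    {Λ C : ℝ} {F ρ : ι → ℝ} {a : ℕ} (ha : 1 ≤ a) (hΛ : 0 ≤ Λ) (hC : 0 ≤ C) (hρ0 : ∀ i, 0 ≤ ρ i)
    (hρF : ∀ i, ρ i ≤ F i)
    (h : ∀ (j : ι) (I : ℕ), 1 ≤ I →
      Λ ≤ C * ((I : ℝ)⁻¹ * ∏ i, F i + (I : ℝ) ^ a * ∏ i, Function.update F j (ρ j) i)) :
    Λ ≤ C * (1 + 2 ^ a) * ∏ i, ρ i ^ (1 / (2 * a * Fintype.card ι) : ℝ) *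
      F i ^ (1 - 1 / (2 * a * Fintype.card ι) : ℝ) := by
  have hF0 : ∀ i, 0 ≤ F i := fun i => (hρ0 i).trans (hρF i)
  have hN : 0 < Fintype.card ι := Fintype.card_pos
  set N := Fintype.card ι with hNd
  have hN0 : (0 : ℝ) < N := by exact_mod_cast hN
  have ha0 : (0 : ℝ) < a := by exact_mod_cast ha
  -- If some F_j is 0, so is ρ_j, and both products vanish already for I = 1; otherwise the ratios
  -- ρ_j/F_j make sense.
  by_cases hz : ∃ j, F j = 0
  · obtain ⟨j, hj⟩ := hz
    have hρj : ρ j = 0 := le_antisymm (hj ▸ hρF j) (hρ0 j)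
    have h1 := h j 1 le_rfl
    rw [Finset.prod_eq_zero (Finset.mem_univ j) hj, Finset.prod_eq_zero (Finset.mem_univ j)
      (by rw [Function.update_self, hρj])] at h1
    simp only [mul_zero, add_zero] at h1
    refine h1.trans (mul_nonneg (by positivity) (Finset.prod_nonneg fun i _ =>
      mul_nonneg (Real.rpow_nonneg (hρ0 i) _) (Real.rpow_nonneg (hF0 i) _)))
  · push Not at hz
    have hFp : ∀ i, 0 < F i := fun i => (hF0 i).lt_of_ne' (hz i)
    set P := ∏ i, F i with hP
    have hP0 : 0 < P := Finset.prod_pos fun i _ => hFp i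
    set D := C * (1 + 2 ^ a) with hD
    have hD0 : 0 ≤ D := by positivity
    set δ : ℝ := 1 / (2 * a) with hδ
    have hone : ∀ j, Λ ≤ D * P * (ρ j / F j) ^ δ := by
      intro j
      refine le_mul_rpow_of_forall_nat ha (div_nonneg (hρ0 j) (hF0 j))
        (div_le_one_of_le₀ (hρF j) (hF0 j)) hC hP0.le fun I hI => ?_
      have h1 : ∏ i, Function.update F j (ρ j) i = ρ j / F j * P := by
        rw [Finset.prod_update_of_mem (Finset.mem_univ j), hP,
          ← Finset.mul_prod_erase _ _ (Finset.mem_univ j), ← mul_assoc, div_mul_cancel₀ _ (hz j),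
          Finset.sdiff_singleton_eq_erase]
      rw [← h1]
      exact h j I hI
    have hroot : ∀ x : ℝ, 0 ≤ x → ∏ _i : ι, x ^ (1 / N : ℝ) = x := by
      intro x hx
      rw [Finset.prod_const, Finset.card_univ, ← hNd, one_div]
      exact Real.rpow_inv_natCast_pow hx hN.ne'
    -- Geometric mean of the N bounds, one for each distinguished index.
    calc Λ = ∏ _i : ι, Λ ^ (1 / N : ℝ) := (hroot Λ hΛ).symm
      _ ≤ ∏ i : ι, (D * P * (ρ i / F i) ^ δ) ^ (1 / N : ℝ) := by
        refine Finset.prod_le_prod (fun i _ => Real.rpow_nonneg hΛ _) fun i _ => ?_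
        exact Real.rpow_le_rpow hΛ (hone i) (by positivity)
      _ = ∏ i : ι, (D * P) ^ (1 / N : ℝ) * (ρ i / F i) ^ (1 / (2 * a * N) : ℝ) := by
        refine Finset.prod_congr rfl fun i _ => ?_
        have h1 : 0 ≤ ρ i / F i := div_nonneg (hρ0 i) (hF0 i)
        rw [Real.mul_rpow (by positivity) (Real.rpow_nonneg h1 _), ← Real.rpow_mul h1]
        congr 2
        rw [hδ]
        field_simp
      _ = D * P * ∏ i : ι, (ρ i / F i) ^ (1 / (2 * a * N) : ℝ) := by
        rw [Finset.prod_mul_distrib, hroot _ (by positivity)]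
      _ = D * ∏ i, ρ i ^ (1 / (2 * a * N) : ℝ) * F i ^ (1 - 1 / (2 * a * N) : ℝ) := by
        rw [mul_assoc, hP, ← Finset.prod_mul_distrib]
        congr 1
        refine Finset.prod_congr rfl fun i _ => ?_
        rw [Real.div_rpow (hρ0 i) (hF0 i), Real.rpow_sub (hFp i), Real.rpow_one]
        ring

/-! ### Sup norms, the pattern maps and the main theorem -/

theorem norm_le_supNorm {n : ℕ} {g : EuclideanSpace ℝ (Fin n) → ℂ} {M : ℝ}
    (hg : ∀ x, ‖g x‖ ≤ M) (x : EuclideanSpace ℝ (Fin n)) : ‖g x‖ ≤ supNorm g :=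
  le_ciSup (f := fun x => ‖g x‖) ⟨M, by rintro _ ⟨x, rfl⟩; exact hg x⟩ x

theorem supNorm_nonneg {n : ℕ} (g : EuclideanSpace ℝ (Fin n) → ℂ) : 0 ≤ supNorm g :=
  Real.iSup_nonneg fun _ => norm_nonneg _

theorem norm_fourier_le_supNorm {n : ℕ} {g : EuclideanSpace ℝ (Fin n) → ℂ} (hg : Continuous g)
    (hs : tsupport g ⊆ unitCube n) (ξ : EuclideanSpace ℝ (Fin n)) : ‖𝓕 g ξ‖ ≤ supNorm g := by
  have hc : HasCompactSupport g :=
    (isCompact_unitCube n).of_isClosed_subset (isClosed_tsupport g) hs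
  obtain ⟨M, hM⟩ := hc.exists_bound_of_continuous hg
  have h1 : ‖𝓕 g ξ‖ₑ ≤ ENNReal.ofReal (supNorm g) := by
    refine (enorm_fourier_le_lintegral g ξ).trans ?_
    have h2 := lintegral_enorm_pow_le_of_tsupport_subset (volume_unitCube n).le
      (fun x hx => image_eq_zero_of_notMem_tsupport fun h => hx (hs h))
      (N := ENNReal.ofReal (supNorm g)) (fun x => by
        rw [← ofReal_norm]
        exact ENNReal.ofReal_le_ofReal (norm_le_supNorm hM x)) one_ne_zero
    simpa using h2
  rwa [← ofReal_norm, ENNReal.ofReal_le_ofReal_iff (supNorm_nonneg g)] at h1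

theorem patternMap_castSucc {n m k : ℕ} (A : Fin (k + 1) → Matrix (Fin n) (Fin m) ℝ)
    (Q : MvPolynomial (Fin m) ℝ) (j : Fin k) (y : EuclideanSpace ℝ (Fin m)) :
    patternMap A Q j.castSucc y = matrixCLM (A j.castSucc) y := by
  rw [patternMap, if_neg (by simp; omega), add_zero, matrixCLM_apply]

theorem patternMap_last {n m k : ℕ} (A : Fin (k + 1) → Matrix (Fin n) (Fin m) ℝ)
    (Q : MvPolynomial (Fin m) ℝ) (y : EuclideanSpace ℝ (Fin m)) :
    patternMap A Q (Fin.last k) y =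
      matrixCLM (A (Fin.last k)) y + polyValue Q y • lastBasisVector n := by
  rw [patternMap, if_pos (by simp), matrixCLM_apply]

/-- The configuration form as a single integral over `ℝⁿ × ℝᵐ`. -/
theorem configForm_patternMap_eq {n m k : ℕ} (A : Fin (k + 1) → Matrix (Fin n) (Fin m) ℝ)
    (Q : MvPolynomial (Fin m) ℝ)
    {A' : Fin (k + 1) → EuclideanSpace ℝ (Fin m) →L[ℝ] EuclideanSpace ℝ (Fin n)}
    (hA0 : A' 0 = 0) (hAs : ∀ j : Fin k, A' j.succ = matrixCLM (A j.castSucc))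
    {ψ : EuclideanSpace ℝ (Fin m) → ℝ} (hψ : Continuous ψ) (hψc : HasCompactSupport ψ)
    {f : Fin (k + 2) → EuclideanSpace ℝ (Fin n) → ℂ} (hf : ∀ i, Continuous (f i))
    (hfc : HasCompactSupport (f 0)) :
    configForm (patternMap A Q) ψ f =
      ∫ z : EuclideanSpace ℝ (Fin n) × EuclideanSpace ℝ (Fin m),
        (∏ i : Fin (k + 1), f i.castSucc (z.1 + A' i z.2)) * ψ z.2 *
          f (Fin.last (k + 1)) (z.1 + (matrixCLM (A (Fin.last k)) z.2 +
            polyValue Q z.2 • lastBasisVector n)) := by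
  have : (volume : Measure (EuclideanSpace ℝ (Fin n) × EuclideanSpace ℝ (Fin m))).IsAddHaarMeasure
    := Measure.prod.instIsAddHaarMeasure _ _
  have hQ : Continuous (polyValue Q) := (contDiff_polyValue Q).continuous
  have hint : Integrable (fun z : EuclideanSpace ℝ (Fin n) × EuclideanSpace ℝ (Fin m) =>
      (∏ i : Fin (k + 1), f i.castSucc (z.1 + A' i z.2)) * ψ z.2 *
        f (Fin.last (k + 1)) (z.1 + (matrixCLM (A (Fin.last k)) z.2 +
          polyValue Q z.2 • lastBasisVector n))) (volume.prod volume) := by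
    have hprod : Continuous fun z : EuclideanSpace ℝ (Fin n) × EuclideanSpace ℝ (Fin m) =>
        ∏ i : Fin (k + 1), f i.castSucc (z.1 + A' i z.2) :=
      continuous_finsetProd _ fun i _ => (hf _).comp (by fun_prop)
    have hl := hf (Fin.last (k + 1))
    refine Continuous.integrable_of_hasCompactSupport (by fun_prop) ?_
    refine HasCompactSupport.intro (hfc.isCompact.prod hψc.isCompact) fun z hz => ?_
    by_cases h1 : z.1 ∈ tsupport (f 0)
    · have h2 : ψ z.2 = 0 := image_eq_zero_of_notMem_tsupport fun h2 => hz ⟨h1, h2⟩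
      simp [h2]
    · rw [Finset.prod_eq_zero (Finset.mem_univ 0), zero_mul, zero_mul]
      simpa [hA0] using image_eq_zero_of_notMem_tsupport h1
  rw [Measure.volume_eq_prod, integral_prod _ hint, configForm]
  congr 1 with x
  congr 1 with y
  rw [Fin.prod_univ_castSucc (n := k), Fin.prod_univ_succ (n := k)]
  simp only [patternMap_castSucc, patternMap_last, hA0, hAs, Fin.castSucc_zero, Fin.succ_castSucc,
    Fin.succ_last, _root_.zero_apply, add_zero]
  ring

theorem mainTheorem4 (n m k : ℕ) (hn : 1 ≤ n) (hk : 2 ≤ k) (hm : (k - 1) * n < m) :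
    ∃ ε : ℝ, 0 < ε ∧ ε < 1 ∧
      ∀ (A : Fin k → Matrix (Fin n) (Fin m) ℝ) (Q : MvPolynomial (Fin m) ℝ)
        (ψ : EuclideanSpace ℝ (Fin m) → ℝ),
        NonDegenerateSystem A →
        polyValue Q 0 = 0 →
        hessianDet Q 0 ≠ 0 →
        ContDiff ℝ ∞ ψ →
        HasCompactSupport ψ →
        (∀ y, 0 ≤ ψ y) →
        (∃ c : ℝ, 0 < c ∧ ∀ y : EuclideanSpace ℝ (Fin m), (∀ i, |y i| ≤ c) → 1 ≤ ψ y) →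
        (∃ c : ℝ, 0 < c ∧ ∀ y ∈ tsupport ψ, c ≤ |hessianDet Q y|) →
        ∃ C : ℝ, 0 < C ∧
          ∀ f : Fin (k + 1) → EuclideanSpace ℝ (Fin n) → ℂ,
            (∀ j, ContDiff ℝ ∞ (f j)) →
            (∀ j, tsupport (f j) ⊆ unitCube n) →
            ‖configForm (patternMap A Q) ψ f‖ ≤
              C * ∏ j : Fin (k + 1), supNorm (𝓕 (f j)) ^ ε * supNorm (f j) ^ (1 - ε) := by
  obtain ⟨k, rfl⟩ : ∃ k', k = k' + 1 := ⟨k - 1, by omega⟩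
  rw [Nat.add_sub_cancel] at hm
  set a : ℕ := 4 * (m + 1) with ha
  have ha1 : 1 ≤ a := by omega
  have hden : (1 : ℝ) < 2 * a * Fintype.card (Fin (k + 1 + 1)) := by
    rw [Fintype.card_fin]
    exact_mod_cast (by nlinarith : 1 < 2 * a * (k + 1 + 1))
  refine ⟨1 / (2 * a * Fintype.card (Fin (k + 1 + 1))), by positivity,
    (div_lt_one (by linarith)).2 hden, ?_⟩
  intro A Q ψ hA _ _ hψ hψc _ _ ⟨c, hc, hdet⟩
  -- The zero map stands for the point x, so that f₀ is treated like the other linear factors; the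
  -- last matrix is kept apart.
  set A' : Fin (k + 1) → EuclideanSpace ℝ (Fin m) →L[ℝ] EuclideanSpace ℝ (Fin n) :=
    Fin.cons 0 fun j : Fin k => matrixCLM (A j.castSucc) with hA'
  have hA0 : A' 0 = 0 := Fin.cons_zero _ _
  have hAs : ∀ j : Fin k, A' j.succ = matrixCLM (A j.castSucc) := fun j => Fin.cons_succ _ _ _
  obtain ⟨e, he0, he⟩ :=
    exists_ne_zero_forall_apply_eq_zero hm fun j : Fin k => matrixCLM (A j.castSucc)
  have heA : ∀ i, A' i e = 0 := by
    intro i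
    induction i using Fin.cases with
    | zero => rw [hA0, _root_.zero_apply]
    | succ j => rw [hAs, he]
  obtain ⟨Θ, hΘ, hQΘ⟩ := exists_polyValue_add_smul Q e
  obtain ⟨d, Φ, hΦ, hB⟩ := hA.exists_coordinates hA0 hAs
  obtain ⟨C, hC, hmain⟩ := exists_configuration_bound hk hA0 (matrixCLM (A (Fin.last k)))
    (lastBasisVector n) hΦ hB (isCompact_unitCube n) (volume_unitCube n).le
    (contDiff_polyValue Q) hψ hψc heA hΘ hQΘ fun y hy =>
      fderiv_slice_ne_zero_of_hessianDet_ne_zero he0 hΘ hQΘ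
        (abs_pos.1 (hc.trans_le (hdet y hy)))
  rw [finrank_euclideanSpace_fin, ← ha] at hmain
  -- The added 1 ensures positivity; the factor 1 + 2^a comes from optimising the cut-off.
  refine ⟨(C.toReal + 1) * (1 + 2 ^ a), by positivity, fun f hf hfs => ?_⟩
  have hfc : ∀ i, HasCompactSupport (f i) := fun i =>
    (isCompact_unitCube n).of_isClosed_subset (isClosed_tsupport _) (hfs i)
  have hbd : ∀ i x, ‖f i x‖ ≤ supNorm (f i) := fun i => by
    obtain ⟨M, hM⟩ := (hfc i).exists_bound_of_continuous (hf i).continuous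
    exact norm_le_supNorm hM
  have hFbd : ∀ i ξ, ‖𝓕 (f i) ξ‖ ≤ supNorm (f i) := fun i =>
    norm_fourier_le_supNorm (hf i).continuous (hfs i)
  refine le_prod_rpow_of_forall_update (ρ := fun i => supNorm (𝓕 (f i)))
    (F := fun i => supNorm (f i)) ha1 (norm_nonneg _) (by positivity)
    (fun i => supNorm_nonneg _) (fun i => ciSup_le (hFbd i)) fun j I hI => ?_
  set F : Fin (k + 1 + 1) → ℝ := fun i => supNorm (f i) with hF
  have hF0 : ∀ i, 0 ≤ F i := fun i => supNorm_nonneg _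
  set r := supNorm (𝓕 (f j)) with hr
  have hr0 : 0 ≤ r := supNorm_nonneg _
  have h := hmain f (fun i => ENNReal.ofReal (F i)) j (ENNReal.ofReal r) I hf hfs
    (fun i x => by rw [← ofReal_norm]; exact ENNReal.ofReal_le_ofReal (hbd i x))
    (fun ξ => by
      rw [← ofReal_norm]
      exact ENNReal.ofReal_le_ofReal (norm_le_supNorm (hFbd j) ξ)) hI
  rw [← configForm_patternMap_eq A Q hA0 hAs hψ.continuous hψc (fun i => (hf i).continuous)
    (hfc 0)] at h
  have hupd : ∀ i, Function.update (fun i => ENNReal.ofReal (F i)) j (ENNReal.ofReal r) i =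
      ENNReal.ofReal (Function.update F j r i) := fun i =>
    (congrFun (Function.comp_update ENNReal.ofReal F j r) i).symm
  have hu0 : ∀ i, 0 ≤ Function.update F j r i := by
    intro i
    by_cases hi : i = j
    · subst hi
      rwa [Function.update_self]
    · rw [Function.update_of_ne hi]
      exact hF0 i
  have hI0 : (0 : ℝ) < I := by exact_mod_cast hI
  have hprodF : 0 ≤ ∏ i, F i := Finset.prod_nonneg fun i _ => hF0 i
  have hprodU : 0 ≤ ∏ i, Function.update F j r i := Finset.prod_nonneg fun i _ => hu0 i
  simp only [hupd] at h
  rw [← ENNReal.ofReal_prod_of_nonneg fun i _ => hF0 i,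
    ← ENNReal.ofReal_prod_of_nonneg fun i _ => hu0 i, ← ENNReal.ofReal_natCast,
    ← ENNReal.ofReal_inv_of_pos hI0, ← ENNReal.ofReal_pow hI0.le,
    ← ENNReal.ofReal_mul (by positivity), ← ENNReal.ofReal_mul (by positivity),
    ← ENNReal.ofReal_add (by positivity) (by positivity), ← ENNReal.ofReal_toReal hC,
    ← ENNReal.ofReal_mul (by positivity), ← ofReal_norm,
    ENNReal.ofReal_le_ofReal_iff (by positivity)] at h
  refine h.trans (mul_le_mul_of_nonneg_right ?_ (by positivity))
  linarith
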